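/- Let $N\ge 1$, let $\Omega\subset\mathbb R^N$ be a bounded domain with smooth boundary, let $T\in(0,\infty)$, $1<p,q<2$, $m,n>0$, and let $u_0,v_0:\Omega\to\mathbb R$ be initial data (no regularity of $u_0,v_0$ is needed). Write $Q_T=\Omega\times(0,T)$, $\Gamma_T=\partial\Omega\times(0,T)$, and consider the problem $$\begin{cases}u_t=\operatorname{div}(|\nabla u|^{p-2}\nabla u)+v^m,\quad v_t=\operatorname{div}(|\nabla v|^{q-2}\nabla v)+u^n & \text{in } Q_T,\\ u=v=0 & \text{on }\Gamma_T,\\ u(\cdot,0)=u_0,\quad v(\cdot,0)=v_0 & \text{in }\Omega.\end{cases}\tag{P}$$ For $s\in\{p,q\}$ let $E_{s0}$ be the set of $w\in L^2(Q_T)$ with weak spatial gradient $\nabla w\in L^s(Q_T)$ and zero trace on $\Gamma_T$. A pair $(u,v)$ of functions on $Q_T$ that are nonnegative almost everywhere is called a *weak subsolution* of (P) in $Q_T$ if $$u\in L^{2n}(Q_T)\cap L^2(Q_T),\quad u_t\in L^2(Q_T),\quad \nabla u\in L^p(Q_T),$$ $$v\in L^{2m}(Q_T)\cap L^2(Q_T),\quad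 v_t\in L^2(Q_T),\quad \nabla v\in L^q(Q_T)$$ (weak derivatives), if for all $\phi_1\in E_{p0}$ and $\phi_2\in E_{q0}$ with $\phi_1,\phi_2\ge 0$ a.e. $$\iint_{Q_T}\big(u_t\phi_1+|\nabla u|^{p-2}\nabla u\cdot\nabla\phi_1\big)\,dx\,dt\le\iint_{Q_T}v^m\phi_1\,dx\,dt,$$ $$\iint_{Q_T}\big(v_t\phi_2+|\nabla v|^{q-2}\nabla v\cdot\nabla\phi_2\big)\,dx\,dt\le\iint_{Q_T}u^n\phi_2\,dx\,dt,$$ and if $u\le 0$, $v\le 0$ on $\Gamma_T$ in the sense of traces and $u(\cdot,0)\le u_0$, $v(\cdot,0)\le v_0$ a.e. in $\Omega$, where $u(\cdot,0)$, $v(\cdot,0)$ are the limits of $u(\cdot,t)$, $v(\cdot,t)$ in $L^2(\Omega)$ as $t\to0^+$. A *weak supersolution* is a pair of a.e. nonnegative functions in the same spaces that satisfies these conditions with the two integral inequalities and the boundary and initial inequalities reversed (still for all $\phi_1,\phi_2\ge0$). Let $(\overline u,\overline v)$ be a weak supersolution and $(\underline u,\underline v)$ a weak subsolution of (P) in $Q_T$,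 all four functions being essentially bounded in $Q_T$. 1. If there is a constant $\delta>0$ such that $\overline u\ge\delta$ and $\overline v\ge\delta$ a.e. in $Q_T$, then $\overline u\ge\underline u$ and $\overline v\ge\underline v$ a.e. in $Q_T$. 2. If $m\ge1$ and $n\ge1$, then $\overline u\ge\underline u$ and $\overline v\ge\underline v$ a.e. in $Q_T$, without any positive lower bound on $(\overline u,\overline v)$. -/

import Mathlib

open MeasureTheory Set Filter Topology
open scoped ENNReal ContDiff

noncomputable section

namespace FastDiffusion

/-- The Euclidean space `ℝ^N`. -/
abbrev Space (N : ℕ) : Type := EuclideanSpace ℝ (Fin N)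

/-- Space-time `ℝ^N × ℝ`; its points are written `(x, t)`. -/
abbrev SpaceTime (N : ℕ) : Type := Space N × ℝ

variable {N : ℕ}

/-- `Ω` has a smooth boundary: near each boundary point it is the sublevel set `{ρ < 0}` of a
smooth function `ρ` whose differential does not vanish at that point. -/
def HasSmoothBoundary (Ω : Set (Space N)) : Prop :=
  ∀ x ∈ frontier Ω, ∃ (U : Set (Space N)) (ρ : Space N → ℝ),
    IsOpen U ∧ x ∈ U ∧ ContDiff ℝ ∞ ρ ∧ fderiv ℝ ρ x ≠ 0 ∧ Ω ∩ U = {y ∈ U | ρ y < 0}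

/-- A bounded domain (nonempty connected open set) with smooth boundary. -/
structure IsBoundedSmoothDomain (Ω : Set (Space N)) : Prop where
  isOpen : IsOpen Ω
  isConnected : IsConnected Ω
  isBounded : Bornology.IsBounded Ω
  smoothBoundary : HasSmoothBoundary Ω

/-- The cylinder `Q_T = Ω × (0, T)`. -/
def cylinder (Ω : Set (Space N)) (T : ℝ) : Set (SpaceTime N) := Ω ×ˢ Ioo 0 T

/-- Lebesgue measure on `Q_T`. -/
def cylMeasure (Ω : Set (Space N)) (T : ℝ) : Measure (SpaceTime N) :=
  volume.restrict (cylinder Ω T)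

/-- The surface measure of the lateral boundary `Γ_T = ∂Ω × (0, T)`: the product of the
`(N-1)`-dimensional Hausdorff measure on `∂Ω` and Lebesgue measure on `(0, T)`. -/
def lateralMeasure (Ω : Set (Space N)) (T : ℝ) : Measure (SpaceTime N) :=
  ((Measure.hausdorffMeasure ((N : ℝ) - 1)).restrict (frontier Ω)).prod
    (volume.restrict (Ioo 0 T))

/-- `g` is the weak derivative of `w` in `Q_T` in the space-time direction `d`. -/
def HasWeakDeriv (Ω : Set (Space N)) (T : ℝ) (d : SpaceTime N) (w g : SpaceTime N → ℝ) : Prop :=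
  ∀ φ : SpaceTime N → ℝ, ContDiff ℝ ∞ φ → HasCompactSupport φ → tsupport φ ⊆ cylinder Ω T →
    ∫ z, w z * fderiv ℝ φ z d ∂(cylMeasure Ω T) = -∫ z, g z * φ z ∂(cylMeasure Ω T)

/-- `g` is the weak time derivative `∂w/∂t` of `w` in `Q_T`. -/
def HasWeakTimeDeriv (Ω : Set (Space N)) (T : ℝ) (w g : SpaceTime N → ℝ) : Prop :=
  HasWeakDeriv Ω T (0, 1) w g

/-- `G` is the weak spatial gradient `∇w` of `w` in `Q_T`. -/
def HasWeakGrad (Ω : Set (Space N)) (T : ℝ) (w : SpaceTime N → ℝ)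
    (G : SpaceTime N → Space N) : Prop :=
  ∀ i : Fin N, HasWeakDeriv Ω T (EuclideanSpace.single i 1, 0) w (fun z => G z i)

/-- The classical spatial gradient of a function on space-time. -/
def spatialGrad (φ : SpaceTime N → ℝ) (z : SpaceTime N) : Space N :=
  gradient (fun x => φ (x, z.2)) z.1

/-- `g ∈ L^p(Γ_T)` is the trace on `Γ_T` of `w`, where `w, ∇w ∈ L^p(Q_T)` and `G = ∇w`.  The trace
operator is the continuous extension of the restriction map `φ ↦ φ|_{Γ_T}` from functions smooth up
to the boundary, so `g` is the `L^p(Γ_T)` limit of the restrictions of smooth functions which,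
with their gradients, converge to `w` and `∇w` in `L^p(Q_T)`. -/
def HasTrace (Ω : Set (Space N)) (T p : ℝ) (w : SpaceTime N → ℝ) (G : SpaceTime N → Space N)
    (g : SpaceTime N → ℝ) : Prop :=
  MemLp g (ENNReal.ofReal p) (lateralMeasure Ω T) ∧
  ∃ φ : ℕ → SpaceTime N → ℝ, (∀ k, ContDiff ℝ ∞ (φ k)) ∧
    Tendsto (fun k => eLpNorm (fun z => φ k z - w z) (ENNReal.ofReal p) (cylMeasure Ω T))
      atTop (𝓝 0) ∧
    Tendsto (fun k => eLpNorm (fun z => spatialGrad (φ k) z - G z) (ENNReal.ofReal p)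
      (cylMeasure Ω T)) atTop (𝓝 0) ∧
    Tendsto (fun k => eLpNorm (fun z => φ k z - g z) (ENNReal.ofReal p) (lateralMeasure Ω T))
      atTop (𝓝 0)

/-- `a ∈ L²(Ω)` is the initial value `w(·, 0)`: `w(·, t) → a` in `L²(Ω)` as `t → 0+`, outside a
null set of times.  (A function with `w, ∂w/∂t ∈ L²(Q_T)` is continuous in time with values in
`L²(Ω)` after a change on a null set.) -/
def HasInitialValue (Ω : Set (Space N)) (w : SpaceTime N → ℝ) (a : Space N → ℝ) : Prop :=
  MemLp a 2 (volume.restrict Ω) ∧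
  Tendsto (fun t : ℝ => eLpNorm (fun x => w (x, t) - a x) 2 (volume.restrict Ω))
    (𝓝[>] 0 ⊓ ae volume) (𝓝 0)

/-- `w ∈ L^{2r}(Q_T) ∩ L²(Q_T)` with `∂w/∂t = wt ∈ L²(Q_T)` and `∇w = G ∈ L^p(Q_T)`.  With `r = n`
and exponent `p` this is the space `E_n`; with `r = m` and exponent `q` it is `E_m`. -/
structure MemE (Ω : Set (Space N)) (T r p : ℝ) (w wt : SpaceTime N → ℝ)
    (G : SpaceTime N → Space N) : Prop where
  memLp_two_mul : MemLp w (ENNReal.ofReal (2 * r)) (cylMeasure Ω T)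
  memLp_two : MemLp w 2 (cylMeasure Ω T)
  memLp_timeDeriv : MemLp wt 2 (cylMeasure Ω T)
  memLp_grad : MemLp G (ENNReal.ofReal p) (cylMeasure Ω T)
  timeDeriv : HasWeakTimeDeriv Ω T w wt
  grad : HasWeakGrad Ω T w G

/-- `φ ∈ E_{p0}` with `∇φ = G`: `φ ∈ L²(Q_T)`, `∇φ ∈ L^p(Q_T)`, and `φ` has zero trace. -/
structure MemEZero (Ω : Set (Space N)) (T p : ℝ) (φ : SpaceTime N → ℝ)
    (G : SpaceTime N → Space N) : Prop where
  memLp_two : MemLp φ 2 (cylMeasure Ω T)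
  memLp_grad : MemLp G (ENNReal.ofReal p) (cylMeasure Ω T)
  grad : HasWeakGrad Ω T φ G
  trace : HasTrace Ω T p φ G (fun _ => 0)

/-- `∬_{Q_T} (w_t φ + |∇w|^{p-2} ∇w · ∇φ) dx dt`, where `wt = w_t`, `G = ∇w`, `Gφ = ∇φ`. -/
def weakForm (Ω : Set (Space N)) (T p : ℝ) (wt : SpaceTime N → ℝ) (G : SpaceTime N → Space N)
    (φ : SpaceTime N → ℝ) (Gφ : SpaceTime N → Space N) : ℝ :=
  ∫ z, (wt z * φ z + ‖G z‖ ^ (p - 2) * inner ℝ (G z) (Gφ z)) ∂(cylMeasure Ω T)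

/-- `(u, v)` is a nonnegative weak subsolution in `Q_T` of
`u_t = div(|∇u|^{p-2}∇u) + v^m`, `v_t = div(|∇v|^{q-2}∇v) + u^n`,
with zero lateral boundary data and initial data `(u₀, v₀)`. -/
def IsWeakSubsolution (Ω : Set (Space N)) (T p q m n : ℝ) (u₀ v₀ : Space N → ℝ)
    (u v : SpaceTime N → ℝ) : Prop :=
  (∀ᵐ z ∂(cylMeasure Ω T), 0 ≤ u z ∧ 0 ≤ v z) ∧
  ∃ (ut vt : SpaceTime N → ℝ) (Du Dv : SpaceTime N → Space N),
    MemE Ω T n p u ut Du ∧ MemE Ω T m q v vt Dv ∧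
    (∀ φ Dφ, MemEZero Ω T p φ Dφ → (∀ᵐ z ∂(cylMeasure Ω T), 0 ≤ φ z) →
      weakForm Ω T p ut Du φ Dφ ≤ ∫ z, v z ^ m * φ z ∂(cylMeasure Ω T)) ∧
    (∀ φ Dφ, MemEZero Ω T q φ Dφ → (∀ᵐ z ∂(cylMeasure Ω T), 0 ≤ φ z) →
      weakForm Ω T q vt Dv φ Dφ ≤ ∫ z, u z ^ n * φ z ∂(cylMeasure Ω T)) ∧
    (∃ g, HasTrace Ω T p u Du g ∧ ∀ᵐ z ∂(lateralMeasure Ω T), g z ≤ 0) ∧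
    (∃ g, HasTrace Ω T q v Dv g ∧ ∀ᵐ z ∂(lateralMeasure Ω T), g z ≤ 0) ∧
    (∃ a, HasInitialValue Ω u a ∧ ∀ᵐ x ∂(volume.restrict Ω), a x ≤ u₀ x) ∧
    (∃ a, HasInitialValue Ω v a ∧ ∀ᵐ x ∂(volume.restrict Ω), a x ≤ v₀ x)

/-- `(u, v)` is a nonnegative weak supersolution in `Q_T` of the same problem: all inequalities
between the two sides of the problem are reversed. -/
def IsWeakSupersolution (Ω : Set (Space N)) (T p q m n : ℝ) (u₀ v₀ : Space N → ℝ)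
    (u v : SpaceTime N → ℝ) : Prop :=
  (∀ᵐ z ∂(cylMeasure Ω T), 0 ≤ u z ∧ 0 ≤ v z) ∧
  ∃ (ut vt : SpaceTime N → ℝ) (Du Dv : SpaceTime N → Space N),
    MemE Ω T n p u ut Du ∧ MemE Ω T m q v vt Dv ∧
    (∀ φ Dφ, MemEZero Ω T p φ Dφ → (∀ᵐ z ∂(cylMeasure Ω T), 0 ≤ φ z) →
      ∫ z, v z ^ m * φ z ∂(cylMeasure Ω T) ≤ weakForm Ω T p ut Du φ Dφ) ∧
    (∀ φ Dφ, MemEZero Ω T q φ Dφ → (∀ᵐ z ∂(cylMeasure Ω T), 0 ≤ φ z) →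
      ∫ z, u z ^ n * φ z ∂(cylMeasure Ω T) ≤ weakForm Ω T q vt Dv φ Dφ) ∧
    (∃ g, HasTrace Ω T p u Du g ∧ ∀ᵐ z ∂(lateralMeasure Ω T), 0 ≤ g z) ∧
    (∃ g, HasTrace Ω T q v Dv g ∧ ∀ᵐ z ∂(lateralMeasure Ω T), 0 ≤ g z) ∧
    (∃ a, HasInitialValue Ω u a ∧ ∀ᵐ x ∂(volume.restrict Ω), u₀ x ≤ a x) ∧
    (∃ a, HasInitialValue Ω v a ∧ ∀ᵐ x ∂(volume.restrict Ω), v₀ x ≤ a x)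

/-- `w` is (essentially) bounded in `Q_T`. -/
def IsBoundedOn (Ω : Set (Space N)) (T : ℝ) (w : SpaceTime N → ℝ) : Prop :=
  MemLp w ∞ (cylMeasure Ω T)

end FastDiffusion

end

noncomputable section

namespace FastDiffusion

variable {N : ℕ}

/-! Let `U` and `V` be the positive parts of subsolution minus supersolution in the two components.
Test the difference of the two inequalities for the first component with `U * exp (-K t)`. The
gradient term is nonnegative, because `ξ ↦ |ξ|^(p-2) ξ` is monotone. In the time term, the initial
contribution vanishes by the ordering of the initial data, the terminal one is nonnegative, and the
weight leaves `K ∬ U²/2 e^(-Kt)`. The reaction term is at most `Lm ∬ V U e^(-Kt)`. The second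
component is symmetric, with a constant `Ln`. Adding the two estimates and using `UV ≤ U²/2 + V²/2`
gives `U = V = 0` as soon as `K > Lm + Ln`; the exponential weight does the work of Grönwall's
lemma.

The two cases of the theorem differ only in the one-sided Lipschitz bound for `s ↦ s^m`
(`exists_rpow_sub_rpow_le`). Its derivative is unbounded near `0` when `m < 1`, so either the
supersolution stays above some `δ > 0` or the exponent is at least `1`.

Two points need care. First, the test function must have zero trace, and traces are defined through
smooth approximations. The positive part is therefore replaced by the smooth `softPos ε`, which
keeps approximating sequences smooth (`memEZero_softPos`), and `ε → 0` at the end. Second, the time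
term needs a chain rule for a weak derivative. A mollification argument shows that `w` is almost
everywhere its initial value plus the time integral of its derivative
(`ae_eq_initial_add_integral`). Almost every time line then carries an absolutely continuous
function, to which the classical chain rule applies (`energy_on_slice`). -/

/-! ### Smoothed positive part and its primitive. -/

/-- A smooth, nondecreasing, `1`-Lipschitz approximation of the positive part, within `ε` of it. -/
def softPos (ε s : ℝ) : ℝ := ∫ r in (0 : ℝ)..s, Real.smoothTransition (r / ε)

/-- The primitive of `softPos ε` that vanishes at `0`. -/
def softPosPrim (ε s : ℝ) : ℝ := ∫ r in (0 : ℝ)..s, softPos ε r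

lemma continuous_smoothTransition_div (ε : ℝ) :
    Continuous fun r : ℝ => Real.smoothTransition (r / ε) :=
  Real.smoothTransition.continuous.comp (continuous_id.div_const ε)

lemma hasDerivAt_softPos (ε s : ℝ) :
    HasDerivAt (softPos ε) (Real.smoothTransition (s / ε)) s :=
  intervalIntegral.integral_hasDerivAt_right
    ((continuous_smoothTransition_div ε).intervalIntegrable _ _)
    (continuous_smoothTransition_div ε).aestronglyMeasurable.stronglyMeasurableAtFilter
    (continuous_smoothTransition_div ε).continuousAt

lemma deriv_softPos (ε : ℝ) :
    deriv (softPos ε) = fun s => Real.smoothTransition (s / ε) :=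
  funext fun s => (hasDerivAt_softPos ε s).deriv

lemma contDiff_softPos (ε : ℝ) : ContDiff ℝ ∞ (softPos ε) := by
  rw [contDiff_infty_iff_deriv, deriv_softPos]
  exact ⟨fun s => (hasDerivAt_softPos ε s).differentiableAt,
    Real.smoothTransition.contDiff.comp (contDiff_id.div_const ε)⟩

lemma continuous_softPos (ε : ℝ) : Continuous (softPos ε) := (contDiff_softPos ε).continuous

lemma softPos_monotone (ε : ℝ) : Monotone (softPos ε) :=
  monotone_of_deriv_nonneg (fun s => (hasDerivAt_softPos ε s).differentiableAt)
    fun s => by rw [deriv_softPos]; exact Real.smoothTransition.nonneg _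

lemma softPos_of_nonpos {ε s : ℝ} (hε : 0 < ε) (hs : s ≤ 0) : softPos ε s = 0 := by
  have : ∀ r ∈ uIcc 0 s, Real.smoothTransition (r / ε) = 0 := fun r hr => by
    rw [uIcc_of_ge hs] at hr
    exact Real.smoothTransition.zero_of_nonpos (div_nonpos_of_nonpos_of_nonneg hr.2 hε.le)
  rw [softPos, intervalIntegral.integral_congr this]
  simp

lemma softPos_nonneg {ε : ℝ} (hε : 0 < ε) (s : ℝ) : 0 ≤ softPos ε s := by
  rcases le_total s 0 with h | h
  · exact (softPos_of_nonpos hε h).ge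
  · exact (softPos_of_nonpos hε le_rfl).symm.le.trans (softPos_monotone ε h)

lemma abs_softPos_sub_le (ε a b : ℝ) : |softPos ε a - softPos ε b| ≤ |a - b| := by
  have := Convex.norm_image_sub_le_of_norm_hasDerivWithin_le (s := univ) (C := 1)
    (f := softPos ε) (f' := fun s => Real.smoothTransition (s / ε)) (x := b) (y := a)
    (fun s _ => (hasDerivAt_softPos ε s).hasDerivWithinAt)
    (fun s _ => by
      rw [Real.norm_of_nonneg (Real.smoothTransition.nonneg _)]
      exact Real.smoothTransition.le_one _) convex_univ (mem_univ _) (mem_univ _)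
  simpa using this

lemma abs_softPos_le {ε : ℝ} (hε : 0 < ε) (s : ℝ) : |softPos ε s| ≤ |s| := by
  simpa [softPos_of_nonpos hε le_rfl] using abs_softPos_sub_le ε s 0

lemma softPos_le_posPart {ε : ℝ} (hε : 0 < ε) (s : ℝ) : softPos ε s ≤ max s 0 := by
  rcases le_total s 0 with h | h
  · rw [softPos_of_nonpos hε h]; exact le_max_right _ _
  · have := abs_softPos_sub_le ε s 0
    rw [softPos_of_nonpos hε le_rfl, sub_zero, sub_zero, abs_of_nonneg h] at this
    exact (le_abs_self _).trans (this.trans (le_max_left _ _))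

/-- Beyond `ε` the slope is exactly `1`, so the smoothing loses at most `ε`. -/
lemma sub_le_softPos {ε : ℝ} (hε : 0 < ε) {s : ℝ} : s - ε ≤ softPos ε s := by
  rcases le_total s ε with h | h
  · exact (sub_nonpos.2 h).trans (softPos_nonneg hε s)
  · have h1 : softPos ε s = softPos ε ε + ∫ r in ε..s, Real.smoothTransition (r / ε) :=
      (intervalIntegral.integral_add_adjacent_intervals
        ((continuous_smoothTransition_div ε).intervalIntegrable _ _)
        ((continuous_smoothTransition_div ε).intervalIntegrable _ _)).symm
    have h2 : ∫ r in ε..s, Real.smoothTransition (r / ε) = ∫ r in ε..s, (1 : ℝ) :=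
      intervalIntegral.integral_congr fun r hr => by
        rw [uIcc_of_le h] at hr
        exact Real.smoothTransition.one_of_one_le ((one_le_div hε).2 hr.1)
    rw [h1, h2, intervalIntegral.integral_const, smul_eq_mul, mul_one]
    linarith [softPos_nonneg hε ε]

lemma hasDerivAt_softPosPrim (ε s : ℝ) : HasDerivAt (softPosPrim ε) (softPos ε s) s :=
  intervalIntegral.integral_hasDerivAt_right ((continuous_softPos ε).intervalIntegrable _ _)
    (continuous_softPos ε).aestronglyMeasurable.stronglyMeasurableAtFilter
    (continuous_softPos ε).continuousAt

lemma contDiff_softPosPrim (ε : ℝ) : ContDiff ℝ 1 (softPosPrim ε) := by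
  rw [contDiff_one_iff_deriv]
  refine ⟨fun s => (hasDerivAt_softPosPrim ε s).differentiableAt, ?_⟩
  rw [funext fun s => (hasDerivAt_softPosPrim ε s).deriv]
  exact continuous_softPos ε

lemma softPosPrim_of_nonpos {ε s : ℝ} (hε : 0 < ε) (hs : s ≤ 0) : softPosPrim ε s = 0 := by
  have : ∀ r ∈ uIcc 0 s, softPos ε r = 0 := fun r hr => by
    rw [uIcc_of_ge hs] at hr
    exact softPos_of_nonpos hε hr.2
  rw [softPosPrim, intervalIntegral.integral_congr this]
  simp

lemma softPosPrim_nonneg {ε : ℝ} (hε : 0 < ε) (s : ℝ) : 0 ≤ softPosPrim ε s := by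
  rcases le_total s 0 with h | h
  · exact (softPosPrim_of_nonpos hε h).ge
  · exact intervalIntegral.integral_nonneg h fun r _ => softPos_nonneg hε r

/-- Integrating `r - ε ≤ softPos ε r` gives the bound; it recovers the full quadratic energy as `ε →
0`. -/
lemma sq_posPart_sub_le_softPosPrim {ε : ℝ} (hε : 0 < ε) (s : ℝ) :
    max s 0 ^ 2 / 2 - ε * max s 0 ≤ softPosPrim ε s := by
  rcases le_total s 0 with h | h
  · rw [softPosPrim_of_nonpos hε h, max_eq_right h]; simp
  · rw [max_eq_left h]
    have h1 : ∫ r in (0 : ℝ)..s, (r - ε) = s ^ 2 / 2 - ε * s := by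
      rw [intervalIntegral.integral_sub (f := fun r => r) (g := fun _ => ε)
        (continuous_id.intervalIntegrable _ _) (continuous_const.intervalIntegrable _ _),
        integral_id]
      simp; ring
    rw [← h1]
    exact intervalIntegral.integral_mono_on h
      ((continuous_id.sub continuous_const).intervalIntegrable _ _)
      ((continuous_softPos ε).intervalIntegrable _ _) fun r _ => sub_le_softPos hε

/-! ### Pointwise inequalities for the diffusion and the reaction. -/

/-- The vector field `ξ ↦ |ξ|^{p-2} ξ` is monotone. -/
lemma inner_pLaplace_sub_nonneg {E : Type*} [NormedAddCommGroup E] [InnerProductSpace ℝ E]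
    {p : ℝ} (hp : 1 < p) (a b : E) :
    0 ≤ ‖a‖ ^ (p - 2) * inner ℝ a (a - b) - ‖b‖ ^ (p - 2) * inner ℝ b (a - b) := by
  -- The exponent `p - 2` may be negative, but the extra factor `x` makes the value of `0 ^ (p - 2)`
  -- irrelevant; only `p - 1 ≠ 0` matters at `x = 0`.
  have key : ∀ x : ℝ, 0 ≤ x → x ^ (p - 2) * x = x ^ (p - 1) := fun x hx => by
    rcases hx.eq_or_lt with rfl | hx
    · rw [mul_zero, Real.zero_rpow (by linarith)]
    · rw [← Real.rpow_add_one hx.ne']; congr 1; ring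
  have hmono : 0 ≤ (‖a‖ ^ (p - 1) - ‖b‖ ^ (p - 1)) * (‖a‖ - ‖b‖) := by
    rcases le_total ‖a‖ ‖b‖ with h | h
    · exact mul_nonneg_of_nonpos_of_nonpos
        (sub_nonpos.2 (Real.rpow_le_rpow (norm_nonneg _) h (by linarith))) (sub_nonpos.2 h)
    · exact mul_nonneg (sub_nonneg.2 (Real.rpow_le_rpow (norm_nonneg _) h (by linarith)))
        (sub_nonneg.2 h)
  have hA : 0 ≤ ‖a‖ ^ (p - 2) := Real.rpow_nonneg (norm_nonneg _) _
  have hB : 0 ≤ ‖b‖ ^ (p - 2) := Real.rpow_nonneg (norm_nonneg _) _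
  have hab := real_inner_le_norm a b
  rw [← key _ (norm_nonneg a), ← key _ (norm_nonneg b)] at hmono
  rw [inner_sub_right, inner_sub_right, real_inner_self_eq_norm_sq, real_inner_self_eq_norm_sq,
    real_inner_comm a b]
  -- By Cauchy–Schwarz the expression is at least the scalar product in `hmono`.
  nlinarith [mul_le_mul_of_nonneg_left hab hA, mul_le_mul_of_nonneg_left hab hB]

/-- Replacing the smaller of the two norms by the larger in `‖a‖^(p-1) ‖b‖` gives a crude form of
Young's inequality, enough for integrability. -/
lemma abs_pLaplace_inner_le {E : Type*} [NormedAddCommGroup E] [InnerProductSpace ℝ E]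
    {p : ℝ} (hp : 1 < p) (a b : E) :
    |‖a‖ ^ (p - 2) * inner ℝ a b| ≤ ‖a‖ ^ p + ‖b‖ ^ p := by
  have hA : 0 ≤ ‖a‖ ^ (p - 2) := Real.rpow_nonneg (norm_nonneg _) _
  have hp0 : (0 : ℝ) ≤ p - 1 := by linarith
  have key : ∀ x : ℝ, 0 ≤ x → x ^ (p - 1) * x = x ^ p := fun x hx => by
    rcases hx.eq_or_lt with rfl | hx
    · rw [mul_zero, Real.zero_rpow (by linarith)]
    · rw [← Real.rpow_add_one hx.ne']; congr 1; ring
  have key2 : ‖a‖ ^ (p - 2) * ‖a‖ = ‖a‖ ^ (p - 1) := by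
    rcases (norm_nonneg a).eq_or_lt with h | hx
    · rw [← h, mul_zero, Real.zero_rpow (by linarith)]
    · rw [← Real.rpow_add_one hx.ne']; congr 1; ring
  rw [abs_mul, abs_of_nonneg hA]
  have h1 : ‖a‖ ^ (p - 2) * |inner ℝ a b| ≤ ‖a‖ ^ (p - 1) * ‖b‖ := by
    rw [← key2, mul_assoc]
    exact mul_le_mul_of_nonneg_left (abs_real_inner_le_norm a b) hA
  have ha := Real.rpow_nonneg (norm_nonneg a) p
  have hb := Real.rpow_nonneg (norm_nonneg b) p
  rcases le_total ‖a‖ ‖b‖ with h | h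
  · have := mul_le_mul_of_nonneg_right (Real.rpow_le_rpow (norm_nonneg _) h hp0) (norm_nonneg b)
    rw [key _ (norm_nonneg b)] at this
    linarith
  · have := mul_le_mul_of_nonneg_left h (Real.rpow_nonneg (norm_nonneg a) (p - 1))
    rw [key _ (norm_nonneg a)] at this
    linarith

/-- One-sided Lipschitz bound for `s ↦ s ^ m` on bounded sets, valid away from `0` or when the
exponent is at least `1`. -/
lemma exists_rpow_sub_rpow_le {m δ : ℝ} (hm : 0 < m) (hδ : 0 ≤ δ) (h : 0 < δ ∨ 1 ≤ m) (M : ℝ) :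
    ∃ L : ℝ, 0 ≤ L ∧ ∀ a b : ℝ, 0 ≤ a → a ≤ M → δ ≤ b → a ^ m - b ^ m ≤ L * max (a - b) 0 := by
  -- On `[b, a] ⊆ [δ, M]` the derivative `m x^(m-1)` is largest at the right end if `m ≥ 1` and at
  -- the left end if `m ≤ 1`; the sum covers both. The `⊔ 0` is there because `M` has no prescribed
  -- sign.
  refine ⟨m * (δ ^ (m - 1) + M ^ (m - 1)) ⊔ 0, le_max_right _ _, fun a b ha haM hb => ?_⟩
  set L := m * (δ ^ (m - 1) + M ^ (m - 1)) ⊔ 0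
  rcases le_total a b with hab | hab
  · rw [max_eq_right (sub_nonpos.2 hab), mul_zero]
    exact sub_nonpos.2 (Real.rpow_le_rpow ha hab hm.le)
  · rw [max_eq_left (sub_nonneg.2 hab)]
    have hL : ∀ x ∈ Icc b a, ‖m * x ^ (m - 1)‖ ≤ L := fun x hx => by
      have hx0 : 0 ≤ x := hδ.trans (hb.trans hx.1)
      rw [Real.norm_of_nonneg (mul_nonneg hm.le (Real.rpow_nonneg hx0 _))]
      refine le_trans (mul_le_mul_of_nonneg_left ?_ hm.le) (le_max_left _ _)
      have hδ' := Real.rpow_nonneg hδ (m - 1)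
      have hM' := Real.rpow_nonneg (ha.trans haM) (m - 1)
      rcases le_total 1 m with h1 | h1
      · have := Real.rpow_le_rpow hx0 (hx.2.trans haM) (sub_nonneg.2 h1)
        linarith
      · rcases h with h | h
        · have := Real.rpow_le_rpow_of_nonpos h (hb.trans hx.1) (sub_nonpos.2 h1)
          linarith
        · have : m = 1 := le_antisymm h1 h
          subst this; simp
    have := Convex.norm_image_sub_le_of_norm_hasDerivWithin_le (s := Icc b a) (C := L)
      (f := fun x : ℝ => x ^ m) (f' := fun x => m * x ^ (m - 1)) (x := b) (y := a)
      (fun x hx => (Real.hasDerivAt_rpow_const (by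
        rcases h with h | h
        · exact Or.inl (h.trans_le (hb.trans hx.1)).ne'
        · exact Or.inr h)).hasDerivWithinAt)
      hL (convex_Icc _ _) (left_mem_Icc.2 hab) (right_mem_Icc.2 hab)
    rw [Real.norm_eq_abs, Real.norm_eq_abs, abs_of_nonneg (sub_nonneg.2 hab)] at this
    exact (le_abs_self _).trans this

/-! ### The cylinder measure and convergence in `L^P`. -/

lemma isAddHaarMeasure_volume_spaceTime (N : ℕ) :
    (volume : Measure (SpaceTime N)).IsAddHaarMeasure := by
  rw [Measure.volume_eq_prod]; infer_instance

lemma isFiniteMeasure_cylMeasure {Ω : Set (Space N)} (hΩ : Bornology.IsBounded Ω) (T : ℝ) :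
    IsFiniteMeasure (cylMeasure Ω T) :=
  isFiniteMeasure_restrict.2 ((hΩ.prod (Metric.isBounded_Ioo 0 T)).measure_lt_top.ne)

lemma measurableSet_cylinder {Ω : Set (Space N)} (hΩ : IsOpen Ω) (T : ℝ) :
    MeasurableSet (cylinder Ω T) :=
  hΩ.measurableSet.prod measurableSet_Ioo

lemma ae_mem_cylinder {Ω : Set (Space N)} (hΩ : IsOpen Ω) (T : ℝ) :
    ∀ᵐ z ∂(cylMeasure Ω T), z ∈ cylinder Ω T :=
  ae_restrict_mem (measurableSet_cylinder hΩ T)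

/-- Dominated convergence in `L^P` for a bounded sequence of multipliers tending to zero. -/
lemma tendsto_eLpNorm_smul_zero {α E : Type*} [MeasurableSpace α] {μ : Measure α}
    [NormedAddCommGroup E] [NormedSpace ℝ E] {P : ℝ≥0∞} (hP : P ≠ 0) (hP' : P ≠ ⊤)
    {G : α → E} (hG : MemLp G P μ) {h : ℕ → α → ℝ} (hm : ∀ k, AEStronglyMeasurable (h k) μ)
    {C : ℝ} (hb : ∀ k, ∀ᵐ z ∂μ, |h k z| ≤ C)
    (hlim : ∀ᵐ z ∂μ, Tendsto (fun k => h k z) atTop (𝓝 0)) :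
    Tendsto (fun k => eLpNorm (fun z => h k z • G z) P μ) atTop (𝓝 0) := by
  have hPr : 0 < P.toReal := ENNReal.toReal_pos hP hP'
  simp_rw [eLpNorm_eq_lintegral_rpow_enorm_toReal hP hP']
  have key : Tendsto (fun k => ∫⁻ z, ‖h k z • G z‖ₑ ^ P.toReal ∂μ) atTop (𝓝 0) := by
    have := tendsto_lintegral_of_dominated_convergence' (μ := μ)
      (F := fun k z => ‖h k z • G z‖ₑ ^ P.toReal) (f := fun _ => 0)
      (fun z => ‖C • G z‖ₑ ^ P.toReal)
      (fun k => ((hm k).smul hG.1).enorm.pow_const _)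
      (fun k => by
        filter_upwards [hb k] with z hz
        refine ENNReal.rpow_le_rpow ?_ hPr.le
        rw [enorm_smul, enorm_smul]
        gcongr
        rw [enorm_le_iff_norm_le, Real.norm_eq_abs, Real.norm_eq_abs]
        exact hz.trans (le_abs_self _))
      (lintegral_rpow_enorm_lt_top_of_eLpNorm_lt_top hP hP' (hG.const_smul C).2).ne
      (by
        filter_upwards [hlim] with z hz
        have h1 : Tendsto (fun k => ‖h k z • G z‖ₑ) atTop (𝓝 0) := by
          have := (hz.smul_const (G z)).enorm
          simpa using this
        simpa [ENNReal.zero_rpow_of_pos hPr] using h1.ennrpow_const P.toReal)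
    simpa using this
  have := key.ennrpow_const (1 / P.toReal)
  rwa [ENNReal.zero_rpow_of_pos (by positivity)] at this

lemma tendsto_eLpNorm_of_le {α E F : Type*} [MeasurableSpace α] {μ : Measure α}
    [NormedAddCommGroup E] [NormedAddCommGroup F] {P : ℝ≥0∞} {f : ℕ → α → E} {g : ℕ → α → F} {C : ℝ}
    (hb : ∀ k, ∀ᵐ z ∂μ, ‖f k z‖ ≤ C * ‖g k z‖)
    (hg : Tendsto (fun k => eLpNorm (g k) P μ) atTop (𝓝 0)) :
    Tendsto (fun k => eLpNorm (f k) P μ) atTop (𝓝 0) := by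
  refine tendsto_of_tendsto_of_tendsto_of_le_of_le tendsto_const_nhds
    (h := fun k => ENNReal.ofReal C * eLpNorm (g k) P μ) ?_ (fun _ => zero_le)
    fun k => eLpNorm_le_mul_eLpNorm_of_ae_le_mul (hb k) P
  simpa using ENNReal.Tendsto.const_mul hg (Or.inr ENNReal.ofReal_ne_top)

lemma tendsto_eLpNorm_add {α E : Type*} [MeasurableSpace α] {μ : Measure α}
    [NormedAddCommGroup E] {P : ℝ≥0∞} (hP : 1 ≤ P) {f g : ℕ → α → E}
    (hfm : ∀ k, AEStronglyMeasurable (f k) μ) (hgm : ∀ k, AEStronglyMeasurable (g k) μ)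
    (hf : Tendsto (fun k => eLpNorm (f k) P μ) atTop (𝓝 0))
    (hg : Tendsto (fun k => eLpNorm (g k) P μ) atTop (𝓝 0)) :
    Tendsto (fun k => eLpNorm (f k + g k) P μ) atTop (𝓝 0) := by
  refine tendsto_of_tendsto_of_tendsto_of_le_of_le tendsto_const_nhds
    (by simpa using hf.add hg) (fun _ => zero_le) fun k => eLpNorm_add_le (hfm k) (hgm k) hP

/-- Convergence in `L^P` on a finite measure space implies convergence of integrals against a
bounded function. -/
lemma tendsto_integral_mul_of_eLpNorm {α : Type*} [MeasurableSpace α] {μ : Measure α}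
    [IsFiniteMeasure μ] {P : ℝ≥0∞} (hP : 1 ≤ P) {f : ℕ → α → ℝ} {g ψ : α → ℝ}
    (hfi : ∀ k, Integrable (fun z => f k z * ψ z) μ)
    (hfm : ∀ k, AEStronglyMeasurable (f k) μ) (hgm : AEStronglyMeasurable g μ)
    (hψ : AEStronglyMeasurable ψ μ) {C : ℝ} (hC : ∀ z, |ψ z| ≤ C)
    (hfg : Tendsto (fun k => eLpNorm (fun z => f k z - g z) P μ) atTop (𝓝 0)) :
    Tendsto (fun k => ∫ z, f k z * ψ z ∂μ) atTop (𝓝 (∫ z, g z * ψ z ∂μ)) := by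
  refine tendsto_integral_of_L1' _ (hgm.mul hψ) (Eventually.of_forall hfi) ?_
  refine tendsto_eLpNorm_of_le (C := C) (g := fun k z => f k z - g z) (fun k => ?_) ?_
  · refine Eventually.of_forall fun z => ?_
    rw [Pi.sub_apply, Pi.mul_apply, ← sub_mul, norm_mul, mul_comm]
    exact mul_le_mul_of_nonneg_right (hC z) (norm_nonneg _)
  · refine tendsto_of_tendsto_of_tendsto_of_le_of_le tendsto_const_nhds ?_ (fun _ => zero_le)
      fun k => eLpNorm_le_eLpNorm_mul_rpow_measure_univ hP ((hfm k).sub hgm)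
    have hpow : (1 : ℝ) / (1 : ℝ≥0∞).toReal - 1 / P.toReal ≥ 0 := by
      rcases eq_or_ne P ⊤ with rfl | hP'
      · simp
      · have : 1 ≤ P.toReal := by
          simpa using (ENNReal.toReal_le_toReal ENNReal.one_ne_top hP').2 hP
        rw [ENNReal.toReal_one, div_one, ge_iff_le, sub_nonneg]
        exact div_le_one_of_le₀ this (by linarith)
    simpa using ENNReal.Tendsto.mul_const hfg
      (Or.inr (ENNReal.rpow_ne_top_of_nonneg hpow (measure_ne_top μ univ)))

/-! ### Weak gradients, traces and admissible test functions. -/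

lemma spatialGrad_apply {φ : SpaceTime N → ℝ} {z : SpaceTime N} (hφ : DifferentiableAt ℝ φ z)
    (i : Fin N) : spatialGrad φ z i = fderiv ℝ φ z (EuclideanSpace.single i 1, 0) := by
  have h1 : HasFDerivAt (fun x => φ (x, z.2))
      ((fderiv ℝ φ z).comp (ContinuousLinearMap.inl ℝ (Space N) ℝ)) z.1 :=
    HasFDerivAt.comp z.1 (f := fun x => (x, z.2)) hφ.hasFDerivAt (hasFDerivAt_prodMk_left z.1 z.2)
  have h2 : inner ℝ (spatialGrad φ z) (EuclideanSpace.single i (1 : ℝ)) =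
      fderiv ℝ φ z (EuclideanSpace.single i 1, 0) := by
    rw [spatialGrad, gradient, InnerProductSpace.toDual_symm_apply, h1.fderiv]
    rfl
  rw [← h2, EuclideanSpace.inner_single_right]
  simp

lemma continuous_spatialGrad {φ : SpaceTime N → ℝ} (hφ : ContDiff ℝ ∞ φ) :
    Continuous (spatialGrad φ) := by
  have h : spatialGrad φ = fun z => WithLp.toLp 2 fun i : Fin N =>
      fderiv ℝ φ z (EuclideanSpace.single i 1, 0) := by
    funext z; ext i
    exact spatialGrad_apply (hφ.differentiable (by simp) z) i
  rw [h]
  have := hφ.continuous_fderiv (by simp)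
  fun_prop

/-- A limit of smooth functions whose gradients converge as well has a weak gradient, the limit of
the classical ones. -/
lemma hasWeakGrad_of_tendsto {Ω : Set (Space N)} (hΩ : Bornology.IsBounded Ω)
    {T : ℝ} {P : ℝ≥0∞} (hP : 1 ≤ P) {φ : ℕ → SpaceTime N → ℝ} (hφ : ∀ k, ContDiff ℝ ∞ (φ k))
    {w : SpaceTime N → ℝ} {G : SpaceTime N → Space N}
    (hw : AEStronglyMeasurable w (cylMeasure Ω T)) (hG : AEStronglyMeasurable G (cylMeasure Ω T))
    (h0 : Tendsto (fun k => eLpNorm (fun z => φ k z - w z) P (cylMeasure Ω T)) atTop (𝓝 0))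
    (h1 : Tendsto (fun k => eLpNorm (fun z => spatialGrad (φ k) z - G z) P (cylMeasure Ω T))
      atTop (𝓝 0)) :
    HasWeakGrad Ω T w G := by
  have := isFiniteMeasure_cylMeasure hΩ T
  have := isAddHaarMeasure_volume_spaceTime N
  intro i ψ hψ hψc hψs
  set d : SpaceTime N := (EuclideanSpace.single i 1, 0)
  have hψd : Continuous fun z => fderiv ℝ ψ z d :=
    (hψ.continuous_fderiv (by simp)).clm_apply continuous_const
  have hψdc : HasCompactSupport fun z => fderiv ℝ ψ z d := hψc.fderiv_apply ℝ d
  have hφd : ∀ k, Continuous fun z => fderiv ℝ (φ k) z d := fun k =>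
    ((hφ k).continuous_fderiv (by simp)).clm_apply continuous_const
  obtain ⟨C0, hC0⟩ := hψd.bounded_above_of_compact_support hψdc
  obtain ⟨C1, hC1⟩ := hψ.continuous.bounded_above_of_compact_support hψc
  have hI0 : ∀ k, Integrable (fun z => φ k z * fderiv ℝ ψ z d) := fun k =>
    ((hφ k).continuous.mul hψd).integrable_of_hasCompactSupport hψdc.mul_left
  have hI1 : ∀ k, Integrable (fun z => fderiv ℝ (φ k) z d * ψ z) := fun k =>
    ((hφd k).mul hψ.continuous).integrable_of_hasCompactSupport hψc.mul_left
  have hGi : AEStronglyMeasurable (fun z => G z i) (cylMeasure Ω T) :=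
    (show Continuous fun x : Space N => x i by fun_prop).comp_aestronglyMeasurable hG
  have L0 := tendsto_integral_mul_of_eLpNorm (μ := cylMeasure Ω T) hP
    (fun k => (hI0 k).restrict) (fun k => (hφ k).continuous.aestronglyMeasurable) hw
    hψd.aestronglyMeasurable hC0 h0
  have L1 := tendsto_integral_mul_of_eLpNorm (μ := cylMeasure Ω T) hP
    (f := fun k z => fderiv ℝ (φ k) z d) (g := fun z => G z i)
    (fun k => (hI1 k).restrict) (fun k => (hφd k).aestronglyMeasurable) hGi
    hψ.continuous.aestronglyMeasurable hC1
    (tendsto_eLpNorm_of_le (C := 1) (fun k => Eventually.of_forall fun z => by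
      rw [← spatialGrad_apply ((hφ k).differentiable (by simp) z) i, one_mul]
      exact PiLp.norm_apply_le (spatialGrad (φ k) z - G z) i) h1)
  refine tendsto_nhds_unique L0 ?_
  -- Since `ψ` is supported in the cylinder, the integrals extend to the whole space, where
  -- integration by parts has no boundary term.
  have hz : ∀ z, z ∉ cylinder Ω T → ψ z = 0 := fun z hz =>
    image_eq_zero_of_notMem_tsupport fun h => hz (hψs h)
  have hz' : ∀ z, z ∉ cylinder Ω T → fderiv ℝ ψ z d = 0 := fun z hz => by
    rw [fderiv_of_notMem_tsupport ℝ fun h => hz (hψs h)]; rfl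
  have heq : ∀ k, ∫ z, φ k z * fderiv ℝ ψ z d ∂(cylMeasure Ω T) =
      -∫ z, fderiv ℝ (φ k) z d * ψ z ∂(cylMeasure Ω T) := fun k => by
    rw [cylMeasure, setIntegral_eq_integral_of_forall_compl_eq_zero
        (fun z h => by rw [hz' z h, mul_zero]),
      setIntegral_eq_integral_of_forall_compl_eq_zero (fun z h => by rw [hz z h, mul_zero])]
    exact integral_mul_fderiv_eq_neg_fderiv_mul_of_integrable (hI1 k) (hI0 k)
      (((hφ k).continuous.mul hψ.continuous).integrable_of_hasCompactSupport hψc.mul_left)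
      (fun z _ => (hφ k).differentiable (by simp) z) (fun z _ => hψ.differentiable (by simp) z)
  simp_rw [heq]
  exact L1.neg

lemma HasTrace.sub {Ω : Set (Space N)} {T p : ℝ} (hp : 1 ≤ p) {w₁ w₂ : SpaceTime N → ℝ}
    {G₁ G₂ : SpaceTime N → Space N} {g₁ g₂ : SpaceTime N → ℝ}
    (hw₁ : AEStronglyMeasurable w₁ (cylMeasure Ω T))
    (hw₂ : AEStronglyMeasurable w₂ (cylMeasure Ω T))
    (hG₁ : AEStronglyMeasurable G₁ (cylMeasure Ω T))
    (hG₂ : AEStronglyMeasurable G₂ (cylMeasure Ω T))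
    (h₁ : HasTrace Ω T p w₁ G₁ g₁) (h₂ : HasTrace Ω T p w₂ G₂ g₂) :
    HasTrace Ω T p (fun z => w₁ z - w₂ z) (fun z => G₁ z - G₂ z) (fun z => g₁ z - g₂ z) := by
  obtain ⟨hg₁, φ₁, hφ₁, a₁, b₁, c₁⟩ := h₁
  obtain ⟨hg₂, φ₂, hφ₂, a₂, b₂, c₂⟩ := h₂
  have hP : 1 ≤ ENNReal.ofReal p := ENNReal.one_le_ofReal.2 hp
  have aux : ∀ {E : Type} [NormedAddCommGroup E] {μ : Measure (SpaceTime N)}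
      {f₁ f₂ : ℕ → SpaceTime N → E}
      (_ : ∀ k, AEStronglyMeasurable (f₁ k) μ) (_ : ∀ k, AEStronglyMeasurable (f₂ k) μ)
      (_ : Tendsto (fun k => eLpNorm (f₁ k) (ENNReal.ofReal p) μ) atTop (𝓝 0))
      (_ : Tendsto (fun k => eLpNorm (f₂ k) (ENNReal.ofReal p) μ) atTop (𝓝 0)),
      Tendsto (fun k => eLpNorm (fun z => f₁ k z - f₂ k z) (ENNReal.ofReal p) μ) atTop (𝓝 0) := by
    intro E _ μ f₁ f₂ m₁ m₂ l₁ l₂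
    have := tendsto_eLpNorm_add hP m₁ (fun k => (m₂ k).neg) l₁ (by simpa using l₂)
    simpa only [sub_eq_add_neg] using! this
  refine ⟨hg₁.sub hg₂, fun k z => φ₁ k z - φ₂ k z, fun k => (hφ₁ k).sub (hφ₂ k), ?_, ?_, ?_⟩
  · refine (aux (fun k => (hφ₁ k).continuous.aestronglyMeasurable.sub hw₁)
      (fun k => (hφ₂ k).continuous.aestronglyMeasurable.sub hw₂) a₁ a₂).congr fun k => ?_
    congr 1; funext z; simp only [Pi.sub_apply]; ring
  · refine (aux (fun k => (continuous_spatialGrad (hφ₁ k)).aestronglyMeasurable.sub hG₁)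
      (fun k => (continuous_spatialGrad (hφ₂ k)).aestronglyMeasurable.sub hG₂) b₁ b₂).congr
      fun k => ?_
    congr 1; funext z
    have : spatialGrad (fun z => φ₁ k z - φ₂ k z) z =
        spatialGrad (φ₁ k) z - spatialGrad (φ₂ k) z := by
      ext i
      have d₁ := (hφ₁ k).differentiable (by simp) z
      have d₂ := (hφ₂ k).differentiable (by simp) z
      rw [spatialGrad_apply (d₁.fun_sub d₂), PiLp.sub_apply, spatialGrad_apply d₁,
        spatialGrad_apply d₂, fderiv_fun_sub d₁ d₂]
      rfl
    rw [this]; simp only [Pi.sub_apply]; abel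
  · refine (aux (fun k => (hφ₁ k).continuous.aestronglyMeasurable.sub hg₁.1)
      (fun k => (hφ₂ k).continuous.aestronglyMeasurable.sub hg₂.1) c₁ c₂).congr fun k => ?_
    congr 1; funext z; simp only [Pi.sub_apply]; ring

lemma spatialGrad_softPos_mul_exp {φ : SpaceTime N → ℝ} {z : SpaceTime N}
    (hφ : DifferentiableAt ℝ φ z) (ε K : ℝ) :
    spatialGrad (fun z => softPos ε (φ z) * Real.exp (-K * z.2)) z =
      (Real.smoothTransition (φ z / ε) * Real.exp (-K * z.2)) • spatialGrad φ z := by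
  have h1 : HasFDerivAt (fun z => softPos ε (φ z))
      (Real.smoothTransition (φ z / ε) • fderiv ℝ φ z) z :=
    (hasDerivAt_softPos ε (φ z)).comp_hasFDerivAt z hφ.hasFDerivAt
  have h2 : HasFDerivAt (fun z : SpaceTime N => Real.exp (-K * z.2))
      (Real.exp (-K * z.2) • (-K) • ContinuousLinearMap.snd ℝ (Space N) ℝ) z :=
    (hasFDerivAt_snd.const_mul (-K)).exp
  have h3 := h1.fun_mul h2
  ext i
  rw [spatialGrad_apply h3.differentiableAt, PiLp.smul_apply, spatialGrad_apply hφ, h3.fderiv]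
  simp only [add_apply, smul_apply,
    ContinuousLinearMap.coe_snd', smul_eq_mul]
  ring

lemma ae_exp_le_one_lateralMeasure (Ω : Set (Space N)) (T : ℝ) {K : ℝ} (hK : 0 ≤ K) :
    ∀ᵐ z ∂(lateralMeasure Ω T), Real.exp (-K * z.2) ≤ 1 := by
  have h : ∀ᵐ t ∂(volume.restrict (Ioo 0 T)), Real.exp (-K * t) ≤ 1 :=
    (ae_restrict_mem measurableSet_Ioo).mono fun t ht =>
      Real.exp_le_one_iff.2 (by nlinarith [ht.1])
  exact Measure.quasiMeasurePreserving_snd.ae h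

lemma ae_exp_le_one_cylMeasure {Ω : Set (Space N)} (hΩ : IsOpen Ω) (T : ℝ) {K : ℝ} (hK : 0 ≤ K) :
    ∀ᵐ z ∂(cylMeasure Ω T), Real.exp (-K * z.2) ≤ 1 :=
  (ae_mem_cylinder hΩ T).mono fun z hz =>
    Real.exp_le_one_iff.2 (by nlinarith [hz.2.1])

/-- If `w` has nonpositive trace, a smoothed positive part of `w` times `exp (-K t)` is an
admissible test function. -/
lemma memEZero_softPos {Ω : Set (Space N)} (hΩo : IsOpen Ω) (hΩ : Bornology.IsBounded Ω)
    {T p : ℝ} (hp : 1 < p) {w : SpaceTime N → ℝ} {G : SpaceTime N → Space N}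
    {g : SpaceTime N → ℝ} (hw : MemLp w 2 (cylMeasure Ω T))
    (hG : MemLp G (ENNReal.ofReal p) (cylMeasure Ω T)) (htr : HasTrace Ω T p w G g)
    (hg : ∀ᵐ z ∂(lateralMeasure Ω T), g z ≤ 0) {ε : ℝ} (hε : 0 < ε) {K : ℝ} (hK : 0 ≤ K) :
    MemEZero Ω T p (fun z => softPos ε (w z) * Real.exp (-K * z.2))
      (fun z => (Real.smoothTransition (w z / ε) * Real.exp (-K * z.2)) • G z) := by
  have hP : 1 ≤ ENNReal.ofReal p := ENNReal.one_le_ofReal.2 hp.le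
  have hP0 : ENNReal.ofReal p ≠ 0 := (zero_lt_one.trans_le hP).ne'
  have hE : Continuous fun z : SpaceTime N => Real.exp (-K * z.2) := by fun_prop
  have hE1 := ae_exp_le_one_cylMeasure hΩo T hK
  have hst := continuous_smoothTransition_div ε
  have hstm : AEStronglyMeasurable (fun z => Real.smoothTransition (w z / ε) *
      Real.exp (-K * z.2)) (cylMeasure Ω T) :=
    (hst.comp_aestronglyMeasurable hw.1).mul hE.aestronglyMeasurable
  have hstb : ∀ᵐ z ∂(cylMeasure Ω T), ∀ s : ℝ,
      |Real.smoothTransition (s / ε) * Real.exp (-K * z.2)| ≤ 1 := by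
    filter_upwards [hE1] with z hz s
    rw [abs_of_nonneg (mul_nonneg (Real.smoothTransition.nonneg _) (Real.exp_pos _).le)]
    exact mul_le_one₀ (Real.smoothTransition.le_one _) (Real.exp_pos _).le hz
  have hfm : AEStronglyMeasurable (fun z => softPos ε (w z) * Real.exp (-K * z.2))
      (cylMeasure Ω T) :=
    ((continuous_softPos ε).comp_aestronglyMeasurable hw.1).mul hE.aestronglyMeasurable
  have hGm := hstm.smul hG.1
  obtain ⟨hgL, φ, hφ, c0, c1, c2⟩ := htr
  -- The gradient of the composition contains `smoothTransition (φ / ε)`, whose convergence is used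
  -- pointwise; hence a subsequence converging almost everywhere.
  obtain ⟨ns, hns, hae⟩ := (tendstoInMeasure_of_tendsto_eLpNorm hP0
    (fun k => (hφ k).continuous.aestronglyMeasurable) hw.1 c0).exists_seq_tendsto_ae
  have hns' := hns.tendsto_atTop
  set φ' : ℕ → SpaceTime N → ℝ := fun k z => softPos ε (φ (ns k) z) * Real.exp (-K * z.2) with hφ'
  have s1 : ∀ k, ContDiff ℝ ∞ (φ' k) := fun k =>
    ((contDiff_softPos ε).comp (hφ (ns k))).mul (by fun_prop)
  have s2 : Tendsto (fun k => eLpNorm (fun z => φ' k z - softPos ε (w z) * Real.exp (-K * z.2))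
      (ENNReal.ofReal p) (cylMeasure Ω T)) atTop (𝓝 0) := by
    refine tendsto_eLpNorm_of_le (C := 1) (fun k => ?_) (c0.comp hns')
    filter_upwards [hE1] with z hz
    rw [← sub_mul, norm_mul, one_mul, Real.norm_eq_abs, Real.norm_eq_abs, Real.norm_eq_abs,
      abs_of_pos (Real.exp_pos _)]
    exact (mul_le_of_le_one_right (abs_nonneg _) hz).trans (abs_softPos_sub_le ε _ _)
  have s3 : Tendsto (fun k => eLpNorm (fun z => spatialGrad (φ' k) z -
      (Real.smoothTransition (w z / ε) * Real.exp (-K * z.2)) • G z)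
      (ENNReal.ofReal p) (cylMeasure Ω T)) atTop (𝓝 0) := by
    set A : ℕ → SpaceTime N → ℝ := fun k z =>
      Real.smoothTransition (φ (ns k) z / ε) * Real.exp (-K * z.2) with hA
    set B : SpaceTime N → ℝ := fun z =>
      Real.smoothTransition (w z / ε) * Real.exp (-K * z.2) with hB
    have hAc : ∀ k, Continuous (A k) := fun k => (hst.comp (hφ (ns k)).continuous).mul hE
    -- The gradient error splits as `A (∇φ - G) + (A - B) G`: the first term is controlled by `|A| ≤
    -- 1`, the second by dominated convergence.
    have t1 : Tendsto (fun k => eLpNorm (fun z => A k z • (spatialGrad (φ (ns k)) z - G z))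
        (ENNReal.ofReal p) (cylMeasure Ω T)) atTop (𝓝 0) := by
      refine tendsto_eLpNorm_of_le (C := 1) (fun k => ?_) (c1.comp hns')
      filter_upwards [hstb] with z hz
      rw [norm_smul]
      exact mul_le_mul_of_nonneg_right (hz _) (norm_nonneg _)
    have t2 : Tendsto (fun k => eLpNorm (fun z => (A k z - B z) • G z)
        (ENNReal.ofReal p) (cylMeasure Ω T)) atTop (𝓝 0) := by
      refine tendsto_eLpNorm_smul_zero hP0 ENNReal.ofReal_ne_top hG (C := 2)
        (fun k => (hAc k).aestronglyMeasurable.sub hstm) (fun k => ?_) ?_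
      · filter_upwards [hstb] with z hz
        have := abs_sub (A k z) (B z)
        linarith [hz (φ (ns k) z), hz (w z)]
      · filter_upwards [hae] with z hz
        have h1 : Tendsto (fun k => A k z) atTop (𝓝 (B z)) :=
          ((hst.tendsto (w z)).comp hz).mul_const _
        simpa using h1.sub_const (B z)
    refine (tendsto_eLpNorm_add hP
      (fun k => (hAc k).aestronglyMeasurable.smul
        ((continuous_spatialGrad (hφ (ns k))).aestronglyMeasurable.sub hG.1))
      (fun k => ((hAc k).aestronglyMeasurable.sub hstm).smul hG.1) t1 t2).congr fun k => ?_
    congr 1; funext z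
    rw [hφ', spatialGrad_softPos_mul_exp ((hφ (ns k)).differentiable (by simp) z)]
    change A k z • (spatialGrad (φ (ns k)) z - G z) + (A k z - B z) • G z =
      A k z • spatialGrad (φ (ns k)) z - B z • G z
    rw [smul_sub, sub_smul]
    abel
  refine ⟨hw.of_le hfm ?_, hG.of_le hGm ?_, hasWeakGrad_of_tendsto hΩ hP s1 hfm hGm s2 s3,
    MemLp.zero, φ', s1, s2, s3, ?_⟩
  · filter_upwards [hE1] with z hz
    rw [norm_mul, Real.norm_of_nonneg (Real.exp_pos _).le]
    exact (mul_le_of_le_one_right (norm_nonneg _) hz).trans (abs_softPos_le hε _)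
  · filter_upwards [hstb] with z hz
    rw [norm_smul]
    exact mul_le_of_le_one_left (norm_nonneg _) (hz _)
  · refine tendsto_eLpNorm_of_le (C := 1) (fun k => ?_) (c2.comp hns')
    filter_upwards [ae_exp_le_one_lateralMeasure Ω T hK, hg] with z hz hgz
    rw [sub_zero, norm_mul, one_mul, Real.norm_of_nonneg (Real.exp_pos _).le]
    refine (mul_le_of_le_one_right (norm_nonneg _) hz).trans ?_
    -- As `softPos ε` vanishes at `g ≤ 0`, the Lipschitz bound reads `|softPos ε φ| ≤ |φ - g|`, so
    -- the boundary values tend to zero.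
    have := abs_softPos_sub_le ε (φ (ns k) z) (g z)
    rwa [softPos_of_nonpos hε hgz, sub_zero] at this

/-! ### Representation of a function by its initial value and weak time derivative. -/

lemma cylMeasure_eq_prod (Ω : Set (Space N)) (T : ℝ) :
    cylMeasure Ω T = (volume.restrict Ω).prod (volume.restrict (Ioo 0 T)) := by
  rw [Measure.prod_restrict, cylMeasure, cylinder, Measure.volume_eq_prod]

lemma isOpen_cylinder {Ω : Set (Space N)} (hΩ : IsOpen Ω) (T : ℝ) : IsOpen (cylinder Ω T) :=
  hΩ.prod isOpen_Ioo

/-- The time derivative of a mollification of `R` at a point vanishes if the weak time derivative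
of `R` does. -/
lemma hasDerivAt_mollify_zero {Ω : Set (Space N)} {T : ℝ}
    {r R ψ : SpaceTime N → ℝ} (hR : LocallyIntegrable R)
    (hrR : R = (cylinder Ω T).indicator r) (hQ : MeasurableSet (cylinder Ω T))
    (hr0 : HasWeakTimeDeriv Ω T r 0) (hψ : ContDiff ℝ ∞ ψ) (hψc : HasCompactSupport ψ)
    {x : Space N} {t : ℝ} (hsupp : ∀ y, (x, t) - y ∈ tsupport ψ → y ∈ cylinder Ω T) :
    HasDerivAt (fun s => (convolution ψ R (ContinuousLinearMap.lsmul ℝ ℝ) volume) (x, s)) 0 t := by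
  have := isAddHaarMeasure_volume_spaceTime N
  set L : ℝ →L[ℝ] ℝ →L[ℝ] ℝ := ContinuousLinearMap.lsmul ℝ ℝ
  set d : SpaceTime N := (0, 1)
  set z : SpaceTime N := (x, t)
  have h1 := hψc.hasFDerivAt_convolution_left (μ := volume) L (hψ.of_le (by simp)) hR z
  have hpath : HasDerivAt (fun s : ℝ => ((x, s) : SpaceTime N)) d t :=
    (hasDerivAt_const t x).prodMk (hasDerivAt_id t)
  have h2 := h1.comp_hasDerivAt t hpath
  have hint := (hψc.fderiv ℝ).convolutionExists_left (L.precompL (SpaceTime N))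
    (hψ.continuous_fderiv (by simp)) hR z
  have hval : (convolution (fderiv ℝ ψ) R (L.precompL (SpaceTime N)) volume z) d = 0 := by
    rw [convolution, ContinuousLinearMap.integral_apply hint.integrable]
    simp only [ContinuousLinearMap.precompL_apply]
    change ∫ y, fderiv ℝ ψ y d * R (z - y) = 0
    -- After reflection the derivative of the convolution is, up to sign, the weak derivative of `r`
    -- tested against `y ↦ ψ (z - y)`, hence zero.
    rw [← integral_sub_left_eq_self _ volume z]
    simp only [sub_sub_cancel]
    have hφs : tsupport (fun y => ψ (z - y)) ⊆ {y | z - y ∈ tsupport ψ} := by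
      refine closure_minimal (fun y hy => subset_tsupport _ hy) ?_
      exact (isClosed_tsupport ψ).preimage (continuous_const.sub continuous_id)
    have hφc : HasCompactSupport fun y => ψ (z - y) :=
      hψc.comp_homeomorph (Homeomorph.subLeft z)
    have hw := hr0 (fun y => ψ (z - y)) (hψ.comp (contDiff_const.sub contDiff_id)) hφc
      fun y hy => hsupp y (hφs hy)
    simp only [Pi.zero_apply, zero_mul, integral_zero, neg_zero] at hw
    have hfd : ∀ y, fderiv ℝ (fun y => ψ (z - y)) y d = -fderiv ℝ ψ (z - y) d := fun y => by
      have h3 : HasFDerivAt (fun y => ψ (z - y))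
          ((fderiv ℝ ψ (z - y)).comp (-ContinuousLinearMap.id ℝ (SpaceTime N))) y :=
        HasFDerivAt.comp y (hψ.differentiable (by simp) (z - y)).hasFDerivAt
          ((hasFDerivAt_id y).const_sub z)
      rw [h3.fderiv]; simp
    rw [cylMeasure, ← integral_indicator hQ] at hw
    rw [← neg_eq_zero, ← integral_neg, ← hw]
    congr 1; funext y
    change _ = (cylinder Ω T).indicator (fun z_1 => r z_1 * fderiv ℝ (fun y => ψ (z - y)) z_1 d) y
    by_cases hy : y ∈ cylinder Ω T
    · rw [hrR, indicator_of_mem hy, indicator_of_mem hy, hfd]; ring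
    · rw [hrR, indicator_of_notMem hy, indicator_of_notMem hy]; ring
  rw [hval] at h2
  exact h2

/-- A function with vanishing weak time derivative is almost everywhere independent of time. -/
lemma exists_ae_time_independent {Ω : Set (Space N)} (hΩ : IsOpen Ω) {T : ℝ}
    {r : SpaceTime N → ℝ} (hr : Integrable r (cylMeasure Ω T)) (hr0 : HasWeakTimeDeriv Ω T r 0) :
    ∃ E : Set (SpaceTime N), (∀ᵐ z ∂(cylMeasure Ω T), z ∈ E) ∧
      ∀ x t s, (x, t) ∈ E → (x, s) ∈ E → r (x, t) = r (x, s) := by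
  have := isAddHaarMeasure_volume_spaceTime N
  have hQ := measurableSet_cylinder hΩ T
  set R : SpaceTime N → ℝ := (cylinder Ω T).indicator r with hR
  have hRi : LocallyIntegrable R := (IntegrableOn.integrable_indicator hr hQ).locallyIntegrable
  -- The radii shrink with fixed ratio `2`, as the almost everywhere convergence of mollifications
  -- requires.
  let φ : ℕ → ContDiffBump (0 : SpaceTime N) := fun n =>
    ⟨1 / ((n : ℝ) + 1), 2 / ((n : ℝ) + 1), by positivity, by gcongr; norm_num⟩
  have hφ : Tendsto (fun n => (φ n).rOut) atTop (𝓝 0) := by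
    have := (tendsto_one_div_add_atTop_nhds_zero_nat (𝕜 := ℝ)).const_mul 2
    simpa [φ, div_eq_mul_inv] using this
  have hae := ContDiffBump.ae_convolution_tendsto_right_of_locallyIntegrable (μ := volume)
    (K := 2) hφ (Eventually.of_forall fun n => by simp only [φ]; exact (mul_one_div _ _).ge) hRi
  -- `E` consists of the points where the mollifications converge to `R`, so two times over one `x`
  -- can be compared without further exceptional sets.
  refine ⟨{z | z ∈ cylinder Ω T ∧ Tendsto (fun i => (convolution ((φ i).normed volume) R
    (ContinuousLinearMap.lsmul ℝ ℝ) volume) z) atTop (𝓝 (R z))},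
    (ae_mem_cylinder hΩ T).and (ae_restrict_of_ae hae), ?_⟩
  rintro x t s ⟨ht, htl⟩ ⟨hs, hsl⟩
  rw [hR, indicator_of_mem ht, ← hR] at htl
  rw [hR, indicator_of_mem hs, ← hR] at hsl
  have hK : IsCompact (({x} : Set (Space N)) ×ˢ uIcc t s) := isCompact_singleton.prod isCompact_uIcc
  have hKQ : ({x} : Set (Space N)) ×ˢ uIcc t s ⊆ cylinder Ω T := by
    rintro ⟨y, τ⟩ ⟨hy, hτ⟩
    rw [mem_singleton_iff] at hy
    subst hy
    exact ⟨ht.1, (ordConnected_Ioo.uIcc_subset ht.2 hs.2) hτ⟩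
  -- Once the mollification radius is below `δ`, the reflected bumps stay inside the cylinder along
  -- the whole segment, and the mollified function is constant there.
  obtain ⟨δ, hδ, hδQ⟩ := hK.exists_cthickening_subset_open (isOpen_cylinder hΩ T) hKQ
  refine tendsto_nhds_unique htl (hsl.congr' ?_)
  filter_upwards [hφ.eventually (gt_mem_nhds hδ)] with n hn
  have hd : ∀ τ ∈ uIcc t s, HasDerivAt (fun τ => (convolution ((φ n).normed volume) R
      (ContinuousLinearMap.lsmul ℝ ℝ) volume) (x, τ)) 0 τ := fun τ hτ =>
    hasDerivAt_mollify_zero hRi hR hQ hr0 (φ n).contDiff_normed (φ n).hasCompactSupport_normed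
      fun y hy => by
        rw [(φ n).tsupport_normed_eq, mem_closedBall_zero_iff, ← dist_eq_norm] at hy
        refine hδQ (Metric.mem_cthickening_of_dist_le y (x, τ) δ _ ⟨rfl, hτ⟩ ?_)
        rw [dist_comm]; exact hy.trans hn.le
  have := Convex.norm_image_sub_le_of_norm_hasDerivWithin_le (C := 0)
    (fun τ hτ => (hd τ hτ).hasDerivWithinAt) (fun τ _ => by simp) (convex_uIcc t s)
    left_mem_uIcc right_mem_uIcc
  rw [zero_mul, norm_le_zero_iff, sub_eq_zero] at this
  exact this

/-- The primitive in time of `g` that vanishes at time `0`. -/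
def timePrim (g : SpaceTime N → ℝ) (z : SpaceTime N) : ℝ := ∫ s in (0 : ℝ)..z.2, g (z.1, s)

lemma ae_integrable_slice {g : SpaceTime N → ℝ} (hg : Integrable g) :
    ∀ᵐ x : Space N, Integrable fun s => g (x, s) := by
  rw [Measure.volume_eq_prod] at hg
  exact hg.prod_right_ae

/-- The integral of `|g|` over the full time line dominates, and it is integrable by Fubini.
Measurability comes from writing the primitive as a parametric integral of an indicator. -/
lemma integrable_timePrim {Ω : Set (Space N)} (hΩ : IsOpen Ω) (T : ℝ) {g : SpaceTime N → ℝ}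
    (hgm : StronglyMeasurable g) (hg : Integrable g) :
    Integrable (timePrim g) (cylMeasure Ω T) := by
  have hH : Integrable (fun z : SpaceTime N => ∫ s, ‖g (z.1, s)‖) (cylMeasure Ω T) := by
    have hg' := hg
    rw [Measure.volume_eq_prod] at hg'
    rw [cylMeasure_eq_prod]
    exact (hg'.integral_norm_prod_left.restrict (s := Ω)).comp_fst _
  refine hH.mono' ?_ ?_
  · set S : Set (SpaceTime N × ℝ) := {y | 0 < y.2 ∧ y.2 ≤ y.1.2}
    have hS : MeasurableSet S :=
      (measurableSet_lt measurable_const measurable_snd).inter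
        (measurableSet_le measurable_snd (measurable_snd.comp measurable_fst))
    have hk : StronglyMeasurable (S.indicator fun y : SpaceTime N × ℝ => g (y.1.1, y.2)) :=
      (hgm.comp_measurable (by fun_prop)).indicator hS
    refine (hk.integral_prod_right' (ν := (volume : Measure ℝ))).aestronglyMeasurable.congr ?_
    filter_upwards [ae_mem_cylinder hΩ T] with z hz
    rw [timePrim, intervalIntegral.integral_of_le hz.2.1.le, ← integral_indicator measurableSet_Ioc]
    congr 1
  · have h0 : ∀ᵐ z ∂(cylMeasure Ω T), Integrable fun s => g (z.1, s) := by
      rw [cylMeasure_eq_prod]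
      exact Measure.quasiMeasurePreserving_fst.ae (ae_restrict_of_ae (ae_integrable_slice hg))
    filter_upwards [h0] with z hz
    refine (intervalIntegral.norm_integral_le_integral_norm_uIoc).trans ?_
    exact setIntegral_le_integral hz.norm (Eventually.of_forall fun s => norm_nonneg _)

/-- By Fubini it suffices to integrate by parts on almost every time line, where the primitive is
absolutely continuous and the test function vanishes at both ends. -/
lemma hasWeakTimeDeriv_timePrim {Ω : Set (Space N)} (hΩ : IsOpen Ω) {T : ℝ} (hT : 0 ≤ T)
    {g : SpaceTime N → ℝ} (hgm : StronglyMeasurable g) (hg : Integrable g) :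
    HasWeakTimeDeriv Ω T (timePrim g) g := by
  intro φ hφ hφc hφs
  have hφd : Continuous fun z => fderiv ℝ φ z (0, 1) :=
    (hφ.continuous_fderiv (by simp)).clm_apply continuous_const
  obtain ⟨C0, hC0⟩ := hφd.bounded_above_of_compact_support (hφc.fderiv_apply ℝ _)
  obtain ⟨C1, hC1⟩ := hφ.continuous.bounded_above_of_compact_support hφc
  have i0 : Integrable (fun z => timePrim g z * fderiv ℝ φ z (0, 1)) (cylMeasure Ω T) :=
    (integrable_timePrim hΩ T hgm hg).mul_bdd hφd.aestronglyMeasurable (Eventually.of_forall hC0)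
  have i1 : Integrable (fun z => g z * φ z) (cylMeasure Ω T) :=
    (hg.restrict (s := cylinder Ω T)).mul_bdd hφ.continuous.aestronglyMeasurable
      (Eventually.of_forall hC1)
  rw [cylMeasure_eq_prod] at i0 i1 ⊢
  rw [integral_prod _ i0, integral_prod _ i1, ← integral_neg]
  refine integral_congr_ae ?_
  filter_upwards [ae_restrict_of_ae (s := Ω) (ae_integrable_slice hg)] with x hx
  simp only [← integral_Ioc_eq_integral_Ioo, ← intervalIntegral.integral_of_le hT]
  have hxI : IntervalIntegrable (fun s => g (x, s)) volume 0 T := hx.intervalIntegrable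
  have hφx : ContDiff ℝ 1 fun t => φ (x, t) :=
    (hφ.of_le (by simp)).comp (contDiff_const.prodMk contDiff_id)
  have hder : ∀ t, deriv (fun t => φ (x, t)) t = fderiv ℝ φ (x, t) (0, 1) := fun t =>
    ((hφ.differentiable (by simp) (x, t)).hasFDerivAt.comp_hasDerivAt t
      ((hasDerivAt_const t x).prodMk (hasDerivAt_id t))).deriv
  have hz : ∀ t, t ∉ Ioo 0 T → φ (x, t) = 0 := fun t ht =>
    image_eq_zero_of_notMem_tsupport fun h => ht (hφs h).2
  have hibp := AbsolutelyContinuousOnInterval.integral_mul_deriv_eq_deriv_mul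
    (hxI.absolutelyContinuousOnInterval_intervalIntegral (c := 0) left_mem_uIcc)
    (hφx.contDiffOn.absolutelyContinuousOnInterval (a := 0) (b := T))
  rw [hz 0 (by simp), hz T (by simp), mul_zero, mul_zero, sub_zero, zero_sub] at hibp
  simp only [hder] at hibp
  change ∫ t in (0 : ℝ)..T, (∫ s in (0 : ℝ)..t, g (x, s)) * fderiv ℝ φ (x, t) (0, 1) = _
  rw [hibp]
  congr 1
  refine intervalIntegral.integral_congr_ae ?_
  filter_upwards [hxI.ae_hasDerivAt_integral] with t ht htm
  rw [(ht (uIoc_subset_uIcc htm) 0 left_mem_uIcc).deriv]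

/-- An initial value is a limit along this filter; nontriviality lets actual times be picked. -/
lemma neBot_nhdsGT_inf_ae (a : ℝ) : (𝓝[>] a ⊓ ae (volume : Measure ℝ)).NeBot := by
  rw [inf_neBot_iff]
  intro s hs s' hs'
  obtain ⟨b, hb, hbs⟩ := mem_nhdsGT_iff_exists_Ioo_subset.1 hs
  by_contra h
  rw [not_nonempty_iff_eq_empty] at h
  have hsub : Ioo a b ⊆ s'ᶜ := fun x hx hx' => by
    have : x ∈ s ∩ s' := ⟨hbs hx, hx'⟩
    rw [h] at this; exact this
  have := measure_mono_null hsub (mem_ae_iff.1 hs')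
  rw [Real.volume_Ioo, ENNReal.ofReal_eq_zero] at this
  linarith [mem_Ioi.1 hb]

lemma ae_time_ae_space {Ω : Set (Space N)} {T : ℝ} {P : SpaceTime N → Prop}
    (h : ∀ᵐ z ∂(cylMeasure Ω T), P z) :
    ∀ᵐ t ∂(volume.restrict (Ioo 0 T)), ∀ᵐ x ∂(volume.restrict Ω), P (x, t) := by
  rw [cylMeasure_eq_prod] at h
  have := (Measure.measurePreserving_swap (μ := volume.restrict (Ioo 0 T))
    (ν := (volume.restrict Ω : Measure (Space N)))).quasiMeasurePreserving.ae h
  exact Measure.ae_ae_of_ae_prod this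

/-- A function with a square integrable weak time derivative and an initial value is the sum of
its initial value and the time integral of its derivative. -/
theorem ae_eq_initial_add_integral {Ω : Set (Space N)} (hΩo : IsOpen Ω)
    (hΩ : Bornology.IsBounded Ω) {T : ℝ} (hT : 0 < T) {w g : SpaceTime N → ℝ} {a : Space N → ℝ}
    (hw : MemLp w 2 (cylMeasure Ω T)) (hg : MemLp g 2 (cylMeasure Ω T))
    (hwg : HasWeakTimeDeriv Ω T w g) (ha : HasInitialValue Ω w a) :
    ∀ᵐ z ∂(cylMeasure Ω T), w z = a z.1 + timePrim g z := by
  have := isFiniteMeasure_cylMeasure hΩ T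
  have hQ := measurableSet_cylinder hΩo T
  -- a strongly measurable representative of `g`, extended by zero
  have hgI : Integrable g (cylMeasure Ω T) := hg.integrable (by norm_num)
  set g' : SpaceTime N → ℝ := (cylinder Ω T).indicator (hg.1.mk g) with hg'
  have hgm : StronglyMeasurable g' := hg.1.stronglyMeasurable_mk.indicator hQ
  have hgg : ∀ᵐ z ∂(cylMeasure Ω T), g z = g' z := by
    filter_upwards [hg.1.ae_eq_mk, ae_mem_cylinder hΩo T] with z hz hzQ
    rw [hz, hg', indicator_of_mem hzQ]
  have hgi : Integrable g' :=
    IntegrableOn.integrable_indicator (hgI.congr hg.1.ae_eq_mk) hQ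
  set r : SpaceTime N → ℝ := fun z => w z - timePrim g' z with hr
  have hWi := integrable_timePrim hΩo T hgm hgi
  have hwi : Integrable w (cylMeasure Ω T) := hw.integrable (by norm_num)
  have hr0 : HasWeakTimeDeriv Ω T r 0 := by
    intro φ hφ hφc hφs
    have hφd : Continuous fun z => fderiv ℝ φ z (0, 1) :=
      (hφ.continuous_fderiv (by simp)).clm_apply continuous_const
    obtain ⟨C0, hC0⟩ := hφd.bounded_above_of_compact_support (hφc.fderiv_apply ℝ _)
    have e1 := hwg φ hφ hφc hφs
    have e2 := hasWeakTimeDeriv_timePrim hΩo hT.le hgm hgi φ hφ hφc hφs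
    have e3 : ∫ z, g z * φ z ∂(cylMeasure Ω T) = ∫ z, g' z * φ z ∂(cylMeasure Ω T) :=
      integral_congr_ae (hgg.mono fun z hz => by simp only [hz])
    simp only [hr, sub_mul, Pi.zero_apply, zero_mul, integral_zero, neg_zero]
    rw [integral_sub (hwi.mul_bdd hφd.aestronglyMeasurable (Eventually.of_forall hC0))
      (hWi.mul_bdd hφd.aestronglyMeasurable (Eventually.of_forall hC0)), e1, e2, e3, sub_self]
  obtain ⟨E, hE, hEr⟩ := exists_ae_time_independent hΩo (hwi.sub hWi) hr0
  -- a sequence of good times decreasing to zero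
  have hgood : ∀ᵐ t ∂(volume.restrict (Ioo 0 T)),
      (∀ᵐ x ∂(volume.restrict Ω), (x, t) ∈ E) ∧
      AEStronglyMeasurable (fun x => w (x, t)) (volume.restrict Ω) := by
    refine (ae_time_ae_space hE).and ?_
    have hw1 := hw.1
    rw [cylMeasure_eq_prod] at hw1
    exact (hw1.comp_measurePreserving
      (Measure.measurePreserving_swap (μ := volume.restrict (Ioo 0 T)))).prodMk_left
  rw [ae_restrict_iff' measurableSet_Ioo] at hgood
  have hex : ∀ k : ℕ, ∃ t : ℝ, 0 < t ∧ t < 1 / ((k : ℝ) + 1) ∧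
      eLpNorm (fun x => w (x, t) - a x) 2 (volume.restrict Ω) < ENNReal.ofReal (1 / ((k : ℝ) + 1)) ∧
      (∀ᵐ x ∂(volume.restrict Ω), (x, t) ∈ E) ∧
      AEStronglyMeasurable (fun x => w (x, t)) (volume.restrict Ω) := by
    intro k
    have hk : (0 : ℝ) < 1 / ((k : ℝ) + 1) := by positivity
    have := neBot_nhdsGT_inf_ae 0
    have f1 := ha.2.eventually (gt_mem_nhds (ENNReal.ofReal_pos.2 hk))
    have f2 : ∀ᶠ t in 𝓝[>] (0 : ℝ) ⊓ ae volume, t ∈ Ioo 0 (min T (1 / ((k : ℝ) + 1))) :=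
      Eventually.filter_mono inf_le_left (Ioo_mem_nhdsGT (lt_min hT hk))
    have f3 := hgood.filter_mono (inf_le_right (a := 𝓝[>] (0 : ℝ)))
    obtain ⟨t, t1, t2, t3⟩ := (f1.and (f2.and f3)).exists
    exact ⟨t, t2.1, t2.2.trans_le (min_le_right _ _), t1,
      t3 ⟨t2.1, t2.2.trans_le (min_le_left _ _)⟩⟩
  choose τ τ0 τ1 τ2 τ3 τ4 using hex
  have hτ : Tendsto τ atTop (𝓝 0) :=
    squeeze_zero (fun k => (τ0 k).le) (fun k => (τ1 k).le) tendsto_one_div_add_atTop_nhds_zero_nat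
  have hconv : Tendsto (fun k => eLpNorm ((fun x => w (x, τ k)) - a) 2 (volume.restrict Ω))
      atTop (𝓝 0) := by
    refine tendsto_of_tendsto_of_tendsto_of_le_of_le tendsto_const_nhds ?_ (fun _ => zero_le)
      fun k => (τ2 k).le
    simpa using ENNReal.tendsto_ofReal (tendsto_one_div_add_atTop_nhds_zero_nat (𝕜 := ℝ))
  obtain ⟨ns, hns, hae⟩ := (tendstoInMeasure_of_tendsto_eLpNorm (by norm_num) τ4 ha.1.1
    hconv).exists_seq_tendsto_ae
  -- The remainder `r` does not depend on time on `E`, and along the good times `τ (ns k) → 0` it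
  -- tends to `a x`, because the primitive vanishes at time `0`.
  have hX : ∀ᵐ x ∂(volume.restrict Ω), ∀ t, (x, t) ∈ E → r (x, t) = a x := by
    filter_upwards [hae, ae_all_iff.2 τ3, ae_restrict_of_ae (ae_integrable_slice hgi)]
      with x x1 x2 x3 t ht
    have hW : Tendsto (fun k => timePrim g' (x, τ (ns k))) atTop (𝓝 0) := by
      have hc : Continuous fun t => ∫ s in (0 : ℝ)..t, g' (x, s) :=
        intervalIntegral.continuous_primitive (fun _ _ => x3.intervalIntegrable) 0
      have := (hc.tendsto 0).comp (hτ.comp hns.tendsto_atTop)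
      simpa using! this
    have hlim : Tendsto (fun k => r (x, τ (ns k))) atTop (𝓝 (a x)) := by
      simpa using x1.sub hW
    exact tendsto_nhds_unique (tendsto_const_nhds.congr fun k => hEr x t _ ht (x2 (ns k))) hlim
  have hX' : ∀ᵐ z ∂(cylMeasure Ω T), ∀ t, (z.1, t) ∈ E → r (z.1, t) = a z.1 := by
    rw [cylMeasure_eq_prod]; exact Measure.quasiMeasurePreserving_fst.ae hX
  have hgs : ∀ᵐ z ∂(cylMeasure Ω T), ∀ᵐ s ∂(volume.restrict (Ioo 0 T)),
      g (z.1, s) = g' (z.1, s) := by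
    rw [cylMeasure_eq_prod] at hgg ⊢
    exact Measure.quasiMeasurePreserving_fst.ae (Measure.ae_ae_of_ae_prod hgg)
  filter_upwards [hX', hE, hgs, ae_mem_cylinder hΩo T] with z z1 z2 z3 z4
  have e1 : timePrim g z = timePrim g' z := by
    refine intervalIntegral.integral_congr_ae ?_
    rw [ae_restrict_iff' measurableSet_Ioo] at z3
    filter_upwards [z3] with s hs hsm
    rw [uIoc_of_le z4.2.1.le] at hsm
    exact hs ⟨hsm.1, hsm.2.trans_lt z4.2.2⟩
  have e2 : w z - timePrim g' z = a z.1 := z1 z.2 z2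
  rw [e1, ← e2]; ring

/-! ### Energy inequality in time. -/

/-- The range of `f` on the interval is bounded, and a `C¹` function is Lipschitz on bounded
intervals. -/
lemma absolutelyContinuousOnInterval_comp_contDiff {f Φ : ℝ → ℝ} {a b : ℝ}
    (hf : AbsolutelyContinuousOnInterval f a b) (hΦ : ContDiff ℝ 1 Φ) :
    AbsolutelyContinuousOnInterval (fun t => Φ (f t)) a b := by
  obtain ⟨C, hC⟩ := hf.exists_bound
  obtain ⟨K, hK⟩ := hΦ.contDiffOn.exists_lipschitzOnWith (s := Icc (-C) C) (n := 1) (by simp)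
    (convex_Icc _ _) isCompact_Icc
  have hmem : ∀ t ∈ uIcc a b, f t ∈ Icc (-C) C := fun t ht => abs_le.1 (hC t ht)
  unfold AbsolutelyContinuousOnInterval at hf ⊢
  refine squeeze_zero' (Eventually.of_forall fun _ => Finset.sum_nonneg fun i _ => dist_nonneg) ?_
    (by simpa using hf.const_mul (K : ℝ))
  rw [eventually_inf_principal]
  refine Eventually.of_forall fun E hE => ?_
  rw [Finset.mul_sum]
  exact Finset.sum_le_sum fun i hi =>
    hK.dist_le_mul _ (hmem _ (hE.1 i hi).1) _ (hmem _ (hE.1 i hi).2)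

lemma abs_softPosPrim_le {ε : ℝ} (hε : 0 < ε) (s : ℝ) : |softPosPrim ε s| ≤ s ^ 2 := by
  have := intervalIntegral.norm_integral_le_of_norm_le_const (a := 0) (b := s) (C := |s|)
    (f := softPos ε) fun r hr => (abs_softPos_le hε r).trans (by
      rcases le_total 0 s with h | h
      · rw [uIoc_of_le h] at hr
        rw [abs_of_pos hr.1, abs_of_nonneg h]; exact hr.2
      · rw [uIoc_of_ge h] at hr
        rw [abs_of_nonpos hr.2, abs_of_nonpos h]; linarith [hr.1])
  rw [sub_zero, abs_mul_abs_self, ← pow_two] at this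
  exact this

lemma memLp_softPos {α : Type*} [MeasurableSpace α] {μ : Measure α} {P : ℝ≥0∞} {w : α → ℝ}
    (hw : MemLp w P μ) {ε : ℝ} (hε : 0 < ε) : MemLp (fun z => softPos ε (w z)) P μ :=
  hw.of_le ((continuous_softPos ε).comp_aestronglyMeasurable hw.1)
    (Eventually.of_forall fun z => abs_softPos_le hε (w z))

lemma integrable_mul_exp_time {Ω : Set (Space N)} (hΩ : IsOpen Ω) {T K : ℝ} (hK : 0 ≤ K)
    {f : SpaceTime N → ℝ} (hf : Integrable f (cylMeasure Ω T)) :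
    Integrable (fun z => f z * Real.exp (-K * z.2)) (cylMeasure Ω T) := by
  refine hf.mul_bdd (c := 1)
    (show Continuous fun z : SpaceTime N => Real.exp (-K * z.2) by fun_prop).aestronglyMeasurable ?_
  filter_upwards [ae_exp_le_one_cylMeasure hΩ T hK] with z hz
  rwa [Real.norm_of_nonneg (Real.exp_pos _).le]

/-- The energy inequality on a single line in the time direction. -/
lemma energy_on_slice {T K ε c : ℝ} (hε : 0 < ε) (hc : c ≤ 0) {g : ℝ → ℝ}
    (hg : IntervalIntegrable g volume 0 T) :
    0 ≤ ∫ t in (0 : ℝ)..T, (g t * softPos ε (c + ∫ s in (0 : ℝ)..t, g s) * Real.exp (-K * t) -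
      K * (softPosPrim ε (c + ∫ s in (0 : ℝ)..t, g s) * Real.exp (-K * t))) := by
  set W : ℝ → ℝ := fun t => c + ∫ s in (0 : ℝ)..t, g s with hW
  have hWac : AbsolutelyContinuousOnInterval W 0 T :=
    (contDiff_const (n := 1) (c := c)).contDiffOn.absolutelyContinuousOnInterval.fun_add
      (hg.absolutelyContinuousOnInterval_intervalIntegral left_mem_uIcc)
  have hΦac := absolutelyContinuousOnInterval_comp_contDiff hWac (contDiff_softPosPrim ε)
  have hE : ContDiff ℝ 1 fun t : ℝ => Real.exp (-K * t) := by fun_prop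
  have h := AbsolutelyContinuousOnInterval.integral_deriv_mul_eq_sub hΦac
    (hE.contDiffOn.absolutelyContinuousOnInterval (a := 0) (b := T))
  have hW0 : W 0 = c := by simp [hW]
  -- The initial term vanishes since `c ≤ 0`; the terminal term is nonnegative and is the whole
  -- right-hand side.
  rw [hW0, softPosPrim_of_nonpos hε hc, zero_mul, sub_zero] at h
  have h2 : 0 ≤ softPosPrim ε (W T) * Real.exp (-K * T) :=
    mul_nonneg (softPosPrim_nonneg hε _) (Real.exp_pos _).le
  rw [← h] at h2
  refine h2.trans_eq (intervalIntegral.integral_congr_ae ?_)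
  filter_upwards [hg.ae_hasDerivAt_integral] with t ht htm
  have d1 : HasDerivAt W (g t) t :=
    (ht (uIoc_subset_uIcc htm) 0 left_mem_uIcc).const_add c
  have d2 : HasDerivAt (fun t => softPosPrim ε (W t)) (softPos ε (W t) * g t) t :=
    (hasDerivAt_softPosPrim ε (W t)).comp t d1
  have d3 : HasDerivAt (fun t : ℝ => Real.exp (-K * t)) (Real.exp (-K * t) * (-K * 1)) t :=
    ((hasDerivAt_id t).const_mul (-K)).exp
  rw [d2.deriv, d3.deriv]
  ring

/-- The energy inequality for a function whose initial value is nonpositive. -/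
lemma energy_inequality {Ω : Set (Space N)} (hΩo : IsOpen Ω) (hΩ : Bornology.IsBounded Ω)
    {T : ℝ} (hT : 0 < T) {w g : SpaceTime N → ℝ} {a : Space N → ℝ}
    (hw : MemLp w 2 (cylMeasure Ω T)) (hg : MemLp g 2 (cylMeasure Ω T))
    (hrep : ∀ᵐ z ∂(cylMeasure Ω T), w z = a z.1 + timePrim g z)
    (ha : ∀ᵐ x ∂(volume.restrict Ω), a x ≤ 0) {ε : ℝ} (hε : 0 < ε) {K : ℝ} (hK : 0 ≤ K) :
    K * ∫ z, softPosPrim ε (w z) * Real.exp (-K * z.2) ∂(cylMeasure Ω T) ≤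
      ∫ z, g z * (softPos ε (w z) * Real.exp (-K * z.2)) ∂(cylMeasure Ω T) := by
  have := isFiniteMeasure_cylMeasure hΩ T
  have i1 : Integrable (fun z => g z * softPos ε (w z) * Real.exp (-K * z.2)) (cylMeasure Ω T) :=
    integrable_mul_exp_time hΩo hK (hg.integrable_mul (memLp_softPos hw hε))
  have i2 : Integrable (fun z => softPosPrim ε (w z) * Real.exp (-K * z.2)) (cylMeasure Ω T) :=
    integrable_mul_exp_time hΩo hK (hw.integrable_sq.mono'
      ((contDiff_softPosPrim ε).continuous.comp_aestronglyMeasurable hw.1)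
      (Eventually.of_forall fun z => abs_softPosPrim_le hε (w z)))
  have i3 : Integrable (fun z => g z * softPos ε (w z) * Real.exp (-K * z.2) -
      K * (softPosPrim ε (w z) * Real.exp (-K * z.2))) (cylMeasure Ω T) := i1.sub (i2.const_mul K)
  have hgi : Integrable g (cylMeasure Ω T) := hg.integrable (by norm_num)
  simp only [← mul_assoc]
  rw [← sub_nonneg, ← integral_const_mul,
    ← integral_sub i1 (i2.const_mul K)]
  rw [cylMeasure_eq_prod] at hrep hgi i3 ⊢
  rw [integral_prod _ i3]
  refine integral_nonneg_of_ae ?_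
  filter_upwards [ha, Measure.ae_ae_of_ae_prod hrep, hgi.prod_right_ae] with x x1 x2 x3
  have hgx : IntervalIntegrable (fun s => g (x, s)) volume 0 T :=
    (intervalIntegrable_iff_integrableOn_Ioo_of_le hT.le).2 x3
  refine (energy_on_slice (K := K) hε x1 hgx).trans_eq ?_
  rw [intervalIntegral.integral_of_le hT.le, integral_Ioc_eq_integral_Ioo]
  refine integral_congr_ae ?_
  filter_upwards [x2] with t ht
  rw [ht]
  rfl

lemma timePrim_sub_ae {Ω : Set (Space N)} (hΩo : IsOpen Ω) {T : ℝ} {g₁ g₂ : SpaceTime N → ℝ}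
    (h₁ : Integrable g₁ (cylMeasure Ω T)) (h₂ : Integrable g₂ (cylMeasure Ω T)) :
    ∀ᵐ z ∂(cylMeasure Ω T),
      timePrim (fun z => g₁ z - g₂ z) z = timePrim g₁ z - timePrim g₂ z := by
  have aux : ∀ {g : SpaceTime N → ℝ}, Integrable g (cylMeasure Ω T) →
      ∀ᵐ z ∂(cylMeasure Ω T), IntegrableOn (fun s => g (z.1, s)) (Ioo 0 T) := fun {g} hg => by
    rw [cylMeasure_eq_prod] at hg ⊢
    exact Measure.quasiMeasurePreserving_fst.ae hg.prod_right_ae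
  filter_upwards [aux h₁, aux h₂, ae_mem_cylinder hΩo T] with z z1 z2 z3
  have hii : ∀ {f : ℝ → ℝ}, IntegrableOn f (Ioo 0 T) → IntervalIntegrable f volume 0 z.2 :=
    fun hf => (intervalIntegrable_iff_integrableOn_Ioo_of_le z3.2.1.le).2
      (hf.mono_set (Ioo_subset_Ioo_right z3.2.2.le))
  exact intervalIntegral.integral_sub (hii z1) (hii z2)

lemma integrable_pLaplace_inner {α : Type*} [MeasurableSpace α] {μ : Measure α} {p : ℝ}
    (hp : 1 < p) {G H : α → Space N} (hG : MemLp G (ENNReal.ofReal p) μ)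
    (hH : MemLp H (ENNReal.ofReal p) μ) :
    Integrable (fun z => ‖G z‖ ^ (p - 2) * inner ℝ (G z) (H z)) μ := by
  have hp0 : 0 ≤ p := by linarith
  have hP0 : ENNReal.ofReal p ≠ 0 := (ENNReal.ofReal_pos.2 (by linarith)).ne'
  have iG := hG.integrable_norm_rpow hP0 ENNReal.ofReal_ne_top
  have iH := hH.integrable_norm_rpow hP0 ENNReal.ofReal_ne_top
  rw [ENNReal.toReal_ofReal hp0] at iG iH
  exact (iG.add iH).mono'
    ((hG.1.norm.aemeasurable.pow_const _).aestronglyMeasurable.mul (hG.1.inner hH.1))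
    (Eventually.of_forall fun z => abs_pLaplace_inner_le hp (G z) (H z))

/-! ### Scalar comparison estimate. -/

/-- The weighted energy estimate for the positive part of the difference of a subsolution and a
supersolution of two scalar problems. -/
theorem weighted_energy_estimate {Ω : Set (Space N)} (hΩo : IsOpen Ω) (hΩ : Bornology.IsBounded Ω)
    {T : ℝ} (hT : 0 < T) {p r : ℝ} (hp : 1 < p)
    {u₁ u₂ ut₁ ut₂ f₁ f₂ S g₁ g₂ : SpaceTime N → ℝ} {D₁ D₂ : SpaceTime N → Space N}
    {a₁ a₂ u₀ : Space N → ℝ}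
    (hu₁ : MemE Ω T r p u₁ ut₁ D₁) (hu₂ : MemE Ω T r p u₂ ut₂ D₂)
    (hsub : ∀ φ Dφ, MemEZero Ω T p φ Dφ → (∀ᵐ z ∂(cylMeasure Ω T), 0 ≤ φ z) →
      weakForm Ω T p ut₁ D₁ φ Dφ ≤ ∫ z, f₁ z * φ z ∂(cylMeasure Ω T))
    (hsup : ∀ φ Dφ, MemEZero Ω T p φ Dφ → (∀ᵐ z ∂(cylMeasure Ω T), 0 ≤ φ z) →
      ∫ z, f₂ z * φ z ∂(cylMeasure Ω T) ≤ weakForm Ω T p ut₂ D₂ φ Dφ)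
    (htr₁ : HasTrace Ω T p u₁ D₁ g₁) (hg₁ : ∀ᵐ z ∂(lateralMeasure Ω T), g₁ z ≤ 0)
    (htr₂ : HasTrace Ω T p u₂ D₂ g₂) (hg₂ : ∀ᵐ z ∂(lateralMeasure Ω T), 0 ≤ g₂ z)
    (ha₁ : HasInitialValue Ω u₁ a₁) (hau₁ : ∀ᵐ x ∂(volume.restrict Ω), a₁ x ≤ u₀ x)
    (ha₂ : HasInitialValue Ω u₂ a₂) (hau₂ : ∀ᵐ x ∂(volume.restrict Ω), u₀ x ≤ a₂ x)
    (hf₁ : MemLp f₁ 2 (cylMeasure Ω T)) (hf₂ : MemLp f₂ 2 (cylMeasure Ω T))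
    (hS : MemLp S 2 (cylMeasure Ω T)) (hS0 : ∀ z, 0 ≤ S z)
    (hfS : ∀ᵐ z ∂(cylMeasure Ω T), f₁ z - f₂ z ≤ S z) {K : ℝ} (hK : 0 ≤ K) :
    K * ∫ z, max (u₁ z - u₂ z) 0 ^ 2 / 2 * Real.exp (-K * z.2) ∂(cylMeasure Ω T) ≤
      ∫ z, S z * max (u₁ z - u₂ z) 0 * Real.exp (-K * z.2) ∂(cylMeasure Ω T) := by
  have := isFiniteMeasure_cylMeasure hΩ T
  set w : SpaceTime N → ℝ := fun z => u₁ z - u₂ z with hw_def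
  set g : SpaceTime N → ℝ := fun z => ut₁ z - ut₂ z with hg_def
  set G : SpaceTime N → Space N := fun z => D₁ z - D₂ z with hG_def
  have hw : MemLp w 2 (cylMeasure Ω T) := hu₁.memLp_two.sub hu₂.memLp_two
  have hg : MemLp g 2 (cylMeasure Ω T) := hu₁.memLp_timeDeriv.sub hu₂.memLp_timeDeriv
  have hG : MemLp G (ENNReal.ofReal p) (cylMeasure Ω T) := hu₁.memLp_grad.sub hu₂.memLp_grad
  have htr := HasTrace.sub hp.le hu₁.memLp_two.1 hu₂.memLp_two.1 hu₁.memLp_grad.1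
    hu₂.memLp_grad.1 htr₁ htr₂
  have hrep : ∀ᵐ z ∂(cylMeasure Ω T), w z = (a₁ z.1 - a₂ z.1) + timePrim g z := by
    filter_upwards [ae_eq_initial_add_integral hΩo hΩ hT hu₁.memLp_two hu₁.memLp_timeDeriv
        hu₁.timeDeriv ha₁,
      ae_eq_initial_add_integral hΩo hΩ hT hu₂.memLp_two hu₂.memLp_timeDeriv hu₂.timeDeriv ha₂,
      timePrim_sub_ae hΩo (hu₁.memLp_timeDeriv.integrable (by norm_num))
        (hu₂.memLp_timeDeriv.integrable (by norm_num))] with z z1 z2 z3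
    rw [z3]; simp only [hw_def]; rw [z1, z2]; ring
  have hwp : MemLp (fun z => max (w z) 0) 2 (cylMeasure Ω T) := hw.pos_part
  have iA : Integrable (fun z => max (w z) 0 ^ 2 / 2 * Real.exp (-K * z.2)) (cylMeasure Ω T) :=
    integrable_mul_exp_time hΩo hK (hwp.integrable_sq.div_const 2)
  have iB : Integrable (fun z => max (w z) 0 * Real.exp (-K * z.2)) (cylMeasure Ω T) :=
    integrable_mul_exp_time hΩo hK (hwp.integrable (by norm_num))
  have iC : Integrable (fun z => S z * max (w z) 0 * Real.exp (-K * z.2)) (cylMeasure Ω T) :=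
    integrable_mul_exp_time hΩo hK (hS.integrable_mul hwp)
  have key : ∀ ε : ℝ, 0 < ε →
      K * (∫ z, max (w z) 0 ^ 2 / 2 * Real.exp (-K * z.2) ∂(cylMeasure Ω T)) -
        ε * (K * ∫ z, max (w z) 0 * Real.exp (-K * z.2) ∂(cylMeasure Ω T)) ≤
      ∫ z, S z * max (w z) 0 * Real.exp (-K * z.2) ∂(cylMeasure Ω T) := by
    intro ε hε
    set φ : SpaceTime N → ℝ := fun z => softPos ε (w z) * Real.exp (-K * z.2) with hφ_def
    set Dφ : SpaceTime N → Space N := fun z =>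
      (Real.smoothTransition (w z / ε) * Real.exp (-K * z.2)) • G z with hDφ_def
    have hφ : MemEZero Ω T p φ Dφ := memEZero_softPos hΩo hΩ hp hw hG htr
      (by filter_upwards [hg₁, hg₂] with z z1 z2; linarith) hε hK
    have hφ0 : ∀ z, 0 ≤ φ z := fun z => mul_nonneg (softPos_nonneg hε _) (Real.exp_pos _).le
    have iΦ : Integrable (fun z => softPosPrim ε (w z) * Real.exp (-K * z.2)) (cylMeasure Ω T) :=
      integrable_mul_exp_time hΩo hK (hw.integrable_sq.mono'
        ((contDiff_softPosPrim ε).continuous.comp_aestronglyMeasurable hw.1)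
        (Eventually.of_forall fun z => abs_softPosPrim_le hε (w z)))
    have e1 : (∫ z, max (w z) 0 ^ 2 / 2 * Real.exp (-K * z.2) ∂(cylMeasure Ω T)) -
        ε * ∫ z, max (w z) 0 * Real.exp (-K * z.2) ∂(cylMeasure Ω T) ≤
        ∫ z, softPosPrim ε (w z) * Real.exp (-K * z.2) ∂(cylMeasure Ω T) := by
      rw [← integral_const_mul, ← integral_sub iA (iB.const_mul ε)]
      refine integral_mono (iA.sub (iB.const_mul ε)) iΦ fun z => ?_
      have := mul_le_mul_of_nonneg_right (sq_posPart_sub_le_softPosPrim hε (w z))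
        (Real.exp_pos (-K * z.2)).le
      simp only
      linarith
    have e2 := energy_inequality (a := fun x => a₁ x - a₂ x) hΩo hΩ hT hw hg hrep
      (by filter_upwards [hau₁, hau₂] with x x1 x2; linarith) hε hK
    have s1 := hsub φ Dφ hφ (Eventually.of_forall hφ0)
    have s2 := hsup φ Dφ hφ (Eventually.of_forall hφ0)
    have j1 : Integrable (fun z => ut₁ z * φ z) (cylMeasure Ω T) :=
      hu₁.memLp_timeDeriv.integrable_mul hφ.memLp_two
    have j2 : Integrable (fun z => ut₂ z * φ z) (cylMeasure Ω T) :=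
      hu₂.memLp_timeDeriv.integrable_mul hφ.memLp_two
    have k1 := integrable_pLaplace_inner hp hu₁.memLp_grad hφ.memLp_grad
    have k2 := integrable_pLaplace_inner hp hu₂.memLp_grad hφ.memLp_grad
    have l1 : Integrable (fun z => f₁ z * φ z) (cylMeasure Ω T) :=
      hf₁.integrable_mul hφ.memLp_two
    have l2 : Integrable (fun z => f₂ z * φ z) (cylMeasure Ω T) :=
      hf₂.integrable_mul hφ.memLp_two
    have e3 : ∫ z, g z * φ z ∂(cylMeasure Ω T) ≤
        weakForm Ω T p ut₁ D₁ φ Dφ - weakForm Ω T p ut₂ D₂ φ Dφ := by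
      rw [weakForm, weakForm, ← integral_sub (j1.fun_add k1) (j2.fun_add k2)]
      refine integral_mono (hg.integrable_mul hφ.memLp_two) ((j1.fun_add k1).sub (j2.fun_add k2))
        fun z => ?_
      -- The diffusion terms differ by a nonnegative multiple of the monotonicity expression, so
      -- they can be dropped.
      have h1 := mul_nonneg (mul_nonneg (Real.smoothTransition.nonneg (w z / ε))
        (Real.exp_pos (-K * z.2)).le) (inner_pLaplace_sub_nonneg hp (D₁ z) (D₂ z))
      simp only [hDφ_def, hG_def, hg_def, inner_smul_right]
      linarith
    have e4 : (∫ z, f₁ z * φ z ∂(cylMeasure Ω T)) - ∫ z, f₂ z * φ z ∂(cylMeasure Ω T) ≤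
        ∫ z, S z * max (w z) 0 * Real.exp (-K * z.2) ∂(cylMeasure Ω T) := by
      rw [← integral_sub l1 l2]
      refine integral_mono_ae (l1.sub l2) iC ?_
      filter_upwards [hfS] with z hz
      have h1 := mul_le_mul_of_nonneg_right hz (hφ0 z)
      have h2 := mul_le_mul_of_nonneg_left (mul_le_mul_of_nonneg_right
        (softPos_le_posPart hε (w z)) (Real.exp_pos (-K * z.2)).le) (hS0 z)
      simp only [hφ_def] at h1 ⊢
      linarith
    have e5 := mul_le_mul_of_nonneg_left e1 hK
    linarith
  have hlim : Tendsto (fun ε : ℝ =>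
      K * (∫ z, max (w z) 0 ^ 2 / 2 * Real.exp (-K * z.2) ∂(cylMeasure Ω T)) -
        ε * (K * ∫ z, max (w z) 0 * Real.exp (-K * z.2) ∂(cylMeasure Ω T))) (𝓝[>] 0)
      (𝓝 (K * (∫ z, max (w z) 0 ^ 2 / 2 * Real.exp (-K * z.2) ∂(cylMeasure Ω T)) -
        0 * (K * ∫ z, max (w z) 0 * Real.exp (-K * z.2) ∂(cylMeasure Ω T)))) :=
    (Continuous.tendsto (by fun_prop) 0).mono_left nhdsWithin_le_nhds
  rw [zero_mul, sub_zero] at hlim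
  exact le_of_tendsto hlim (eventually_mem_nhdsWithin.mono key)

/-! ### Comparison for the coupled system. -/

lemma exists_ae_abs_le {Ω : Set (Space N)} {T : ℝ} {w : SpaceTime N → ℝ}
    (hw : IsBoundedOn Ω T w) : ∃ M : ℝ, ∀ᵐ z ∂(cylMeasure Ω T), |w z| ≤ M := by
  obtain ⟨M, hM⟩ := eLpNormEssSup_lt_top_iff_isBoundedUnder.1
    (by simpa [eLpNorm_exponent_top] using hw.2)
  exact ⟨M, by simpa [← coe_nnnorm] using! hM⟩

lemma memLp_rpow_of_isBoundedOn {Ω : Set (Space N)} (hΩ : Bornology.IsBounded Ω) {T m : ℝ}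
    (hm : 0 ≤ m) {w : SpaceTime N → ℝ} (hw : IsBoundedOn Ω T w) :
    MemLp (fun z => w z ^ m) 2 (cylMeasure Ω T) := by
  have := isFiniteMeasure_cylMeasure hΩ T
  obtain ⟨M, hM⟩ := exists_ae_abs_le hw
  refine MemLp.of_bound (hw.1.aemeasurable.pow_const m).aestronglyMeasurable (M ^ m) ?_
  filter_upwards [hM] with z hz
  exact (Real.abs_rpow_le_abs_rpow _ _).trans (Real.rpow_le_rpow (abs_nonneg _) hz hm)

/-- The comparison principle under a lower bound `δ` for the supersolution, where `δ` is positive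
or both exponents of the reaction terms are at least `1`. -/
theorem comparison {Ω : Set (Space N)} (hΩo : IsOpen Ω) (hΩ : Bornology.IsBounded Ω)
    {T : ℝ} (hT : 0 < T) {p q m n δ : ℝ} (hp : 1 < p) (hq : 1 < q) (hm : 0 < m) (hn : 0 < n)
    {u₀ v₀ : Space N → ℝ} {uSup vSup uSub vSub : SpaceTime N → ℝ}
    (hSup : IsWeakSupersolution Ω T p q m n u₀ v₀ uSup vSup)
    (hSub : IsWeakSubsolution Ω T p q m n u₀ v₀ uSub vSub)
    (huSup : IsBoundedOn Ω T uSup) (hvSup : IsBoundedOn Ω T vSup)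
    (huSub : IsBoundedOn Ω T uSub) (hvSub : IsBoundedOn Ω T vSub)
    (hδ : 0 ≤ δ) (hδm : 0 < δ ∨ 1 ≤ m) (hδn : 0 < δ ∨ 1 ≤ n)
    (hlow : ∀ᵐ z ∂(cylMeasure Ω T), δ ≤ uSup z ∧ δ ≤ vSup z) :
    ∀ᵐ z ∂(cylMeasure Ω T), uSub z ≤ uSup z ∧ vSub z ≤ vSup z := by
  obtain ⟨-, ut₂, vt₂, Du₂, Dv₂, hu₂, hv₂, eu₂, ev₂, ⟨gu₂, tu₂, su₂⟩, ⟨gv₂, tv₂, sv₂⟩,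
    ⟨au₂, iu₂, ou₂⟩, ⟨av₂, iv₂, ov₂⟩⟩ := hSup
  obtain ⟨hnn, ut₁, vt₁, Du₁, Dv₁, hu₁, hv₁, eu₁, ev₁, ⟨gu₁, tu₁, su₁⟩, ⟨gv₁, tv₁, sv₁⟩,
    ⟨au₁, iu₁, ou₁⟩, ⟨av₁, iv₁, ov₁⟩⟩ := hSub
  obtain ⟨Mu, hMu⟩ := exists_ae_abs_le huSub
  obtain ⟨Mv, hMv⟩ := exists_ae_abs_le hvSub
  obtain ⟨Lm, hLm0, hLm⟩ := exists_rpow_sub_rpow_le hm hδ hδm Mv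
  obtain ⟨Ln, hLn0, hLn⟩ := exists_rpow_sub_rpow_le hn hδ hδn Mu
  -- After Young's inequality the reaction costs `Lm + Ln` times the total energy; the extra `1`
  -- leaves the energy itself at most zero.
  set K : ℝ := Lm + Ln + 1
  have hK : 0 ≤ K := by positivity
  set μ := cylMeasure Ω T
  set U : SpaceTime N → ℝ := fun z => max (uSub z - uSup z) 0
  set V : SpaceTime N → ℝ := fun z => max (vSub z - vSup z) 0
  have hU0 : ∀ z, 0 ≤ U z := fun z => le_max_right _ _
  have hV0 : ∀ z, 0 ≤ V z := fun z => le_max_right _ _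
  have hU : MemLp U 2 μ := (hu₁.memLp_two.sub hu₂.memLp_two).pos_part
  have hV : MemLp V 2 μ := (hv₁.memLp_two.sub hv₂.memLp_two).pos_part
  have E1 : K * ∫ z, U z ^ 2 / 2 * Real.exp (-K * z.2) ∂μ ≤
      ∫ z, Lm * V z * U z * Real.exp (-K * z.2) ∂μ :=
    weighted_energy_estimate hΩo hΩ hT hp hu₁ hu₂ eu₁ eu₂ tu₁ su₁ tu₂ su₂ iu₁ ou₁ iu₂ ou₂
      (memLp_rpow_of_isBoundedOn hΩ hm.le hvSub) (memLp_rpow_of_isBoundedOn hΩ hm.le hvSup)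
      (hV.const_mul Lm) (fun z => mul_nonneg hLm0 (hV0 z))
      (by
        filter_upwards [hnn, hlow, hMv] with z z1 z2 z3
        exact hLm _ _ z1.2 ((le_abs_self _).trans z3) z2.2) hK
  have E2 : K * ∫ z, V z ^ 2 / 2 * Real.exp (-K * z.2) ∂μ ≤
      ∫ z, Ln * U z * V z * Real.exp (-K * z.2) ∂μ :=
    weighted_energy_estimate hΩo hΩ hT hq hv₁ hv₂ ev₁ ev₂ tv₁ sv₁ tv₂ sv₂ iv₁ ov₁ iv₂ ov₂
      (memLp_rpow_of_isBoundedOn hΩ hn.le huSub) (memLp_rpow_of_isBoundedOn hΩ hn.le huSup)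
      (hU.const_mul Ln) (fun z => mul_nonneg hLn0 (hU0 z))
      (by
        filter_upwards [hnn, hlow, hMu] with z z1 z2 z3
        exact hLn _ _ z1.1 ((le_abs_self _).trans z3) z2.1) hK
  have iU : Integrable (fun z => U z ^ 2 / 2 * Real.exp (-K * z.2)) μ :=
    integrable_mul_exp_time hΩo hK (hU.integrable_sq.div_const 2)
  have iV : Integrable (fun z => V z ^ 2 / 2 * Real.exp (-K * z.2)) μ :=
    integrable_mul_exp_time hΩo hK (hV.integrable_sq.div_const 2)
  have iUV : Integrable (fun z => U z * V z * Real.exp (-K * z.2)) μ :=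
    integrable_mul_exp_time hΩo hK (hU.integrable_mul hV)
  have r1 : ∫ z, Lm * V z * U z * Real.exp (-K * z.2) ∂μ =
      Lm * ∫ z, U z * V z * Real.exp (-K * z.2) ∂μ := by
    rw [← integral_const_mul]; congr 1; funext z; ring
  have r2 : ∫ z, Ln * U z * V z * Real.exp (-K * z.2) ∂μ =
      Ln * ∫ z, U z * V z * Real.exp (-K * z.2) ∂μ := by
    rw [← integral_const_mul]; congr 1; funext z; ring
  rw [r1] at E1
  rw [r2] at E2
  have hUn : ∀ z, 0 ≤ U z ^ 2 / 2 * Real.exp (-K * z.2) := fun z => by positivity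
  have hVn : ∀ z, 0 ≤ V z ^ 2 / 2 * Real.exp (-K * z.2) := fun z => by positivity
  have hyoung : ∫ z, U z * V z * Real.exp (-K * z.2) ∂μ ≤
      (∫ z, U z ^ 2 / 2 * Real.exp (-K * z.2) ∂μ) +
        ∫ z, V z ^ 2 / 2 * Real.exp (-K * z.2) ∂μ := by
    rw [← integral_add iU iV]
    refine integral_mono iUV (iU.add iV) fun z => ?_
    simp only [← add_mul]
    exact mul_le_mul_of_nonneg_right (by nlinarith [sq_nonneg (U z - V z)]) (Real.exp_pos _).le
  have hA : 0 ≤ ∫ z, U z ^ 2 / 2 * Real.exp (-K * z.2) ∂μ := integral_nonneg hUn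
  have hB : 0 ≤ ∫ z, V z ^ 2 / 2 * Real.exp (-K * z.2) ∂μ := integral_nonneg hVn
  have hsum : (∫ z, U z ^ 2 / 2 * Real.exp (-K * z.2) ∂μ) +
      ∫ z, V z ^ 2 / 2 * Real.exp (-K * z.2) ∂μ ≤ 0 := by
    have := mul_le_mul_of_nonneg_left hyoung (add_nonneg hLm0 hLn0)
    have hKe : K = Lm + Ln + 1 := rfl
    have hadd := add_le_add E1 E2
    rw [← mul_add, ← add_mul] at hadd
    nlinarith
  have zU := (integral_eq_zero_iff_of_nonneg hUn iU).1 (by linarith)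
  have zV := (integral_eq_zero_iff_of_nonneg hVn iV).1 (by linarith)
  have aux : ∀ {a t : ℝ}, max a 0 ^ 2 / 2 * Real.exp t = 0 → a ≤ 0 := fun {a t} h => by
    have h1 := (mul_eq_zero.1 h).resolve_right (Real.exp_pos t).ne'
    have h2 : max a 0 = 0 := by
      rw [div_eq_zero_iff] at h1
      exact pow_eq_zero_iff (two_ne_zero) |>.1 (h1.resolve_right two_ne_zero)
    exact h2 ▸ le_max_left a 0
  filter_upwards [zU, zV] with z z1 z2
  exact ⟨sub_nonpos.1 (aux z1), sub_nonpos.1 (aux z2)⟩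

end FastDiffusion

end

theorem mainTheorem5 {N : ℕ} (hN : 1 ≤ N) (Ω : Set (FastDiffusion.Space N))
    (hΩ : FastDiffusion.IsBoundedSmoothDomain Ω) (T : ℝ) (hT : 0 < T)
    (p q m n : ℝ) (hp : 1 < p ∧ p < 2) (hq : 1 < q ∧ q < 2) (hm : 0 < m) (hn : 0 < n)
    (u₀ v₀ : FastDiffusion.Space N → ℝ)
    (uSup vSup uSub vSub : FastDiffusion.SpaceTime N → ℝ)
    (hSup : FastDiffusion.IsWeakSupersolution Ω T p q m n u₀ v₀ uSup vSup)
    (hSub : FastDiffusion.IsWeakSubsolution Ω T p q m n u₀ v₀ uSub vSub)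
    (hSup_bdd : FastDiffusion.IsBoundedOn Ω T uSup ∧ FastDiffusion.IsBoundedOn Ω T vSup)
    (hSub_bdd : FastDiffusion.IsBoundedOn Ω T uSub ∧ FastDiffusion.IsBoundedOn Ω T vSub) :
    ((∃ δ : ℝ, 0 < δ ∧ ∀ᵐ z ∂(FastDiffusion.cylMeasure Ω T), δ ≤ uSup z ∧ δ ≤ vSup z) →
      ∀ᵐ z ∂(FastDiffusion.cylMeasure Ω T), uSub z ≤ uSup z ∧ vSub z ≤ vSup z) ∧
    (1 ≤ m → 1 ≤ n →
      ∀ᵐ z ∂(FastDiffusion.cylMeasure Ω T), uSub z ≤ uSup z ∧ vSub z ≤ vSup z) := by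
  refine ⟨fun ⟨δ, hδ, hlow⟩ => ?_, fun hm1 hn1 => ?_⟩
  · exact FastDiffusion.comparison hΩ.isOpen hΩ.isBounded hT hp.1 hq.1 hm hn hSup hSub hSup_bdd.1
      hSup_bdd.2 hSub_bdd.1 hSub_bdd.2 hδ.le (Or.inl hδ) (Or.inl hδ) hlow
  -- Here `δ = 0`: the lower bound is just the nonnegativity contained in `hSup`.
  · exact FastDiffusion.comparison hΩ.isOpen hΩ.isBounded hT hp.1 hq.1 hm hn hSup hSub hSup_bdd.1
      hSup_bdd.2 hSub_bdd.1 hSub_bdd.2 le_rfl (Or.inr hm1) (Or.inr hn1) hSup.1
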